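/- **Theorem.** Let $\mathcal C$ be a class of finite simple graphs of bounded expansion, let $H$ be a finite simple graph, and let $\varepsilon>0$. Then $H$-freeness can be tested on graphs of $\mathcal C$ in the random neighbor model with proximity parameter $\varepsilon$, constant query complexity and one-sided error. That is, there are an integer $q$ and a randomized algorithm $T$ (both may depend on $\mathcal C$, $H$ and $\varepsilon$, but not on the input graph) such that, on every finite input graph $G$, the algorithm $T$ reaches a verdict with probability $1$ and makes at most $q$ oracle queries in every run, and 1. (one-sided error) $T$ accepts every $H$-free graph $G$ with probability $1$; 2. $T$ rejects with probability at least $2/3$ every $G\in\mathcal C$ that is $\varepsilon$-far from being $H$-free. Here the following definitions are used. * *Bounded expansion.* A tree order on $V$ is a partial order in which the elements below any given element are totally ordered. The level of an element is the number of elements strictly below it (so roots have level $0$). A tree embedding of a graph is a tree order on its vertices in which adjacent vertices are comparable, and the treedepth of a graph is the minimum, over its tree embeddings, of the maximal level of a vertex. A $p$-treedepth coloring of $G$ is a coloring of $V(G)$ such that, for every set of $i\le p$ colors, the subgraph induced by the vertices with these colors has treedepth at most $i$. The class $\mathcal C$ has bounded expansion if there is a function $f:\mathbb N\to\mathbb N$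 such that every $G\in\mathcal C$ has, for every $p\in\mathbb N$, a $p$-treedepth coloring with at most $f(p)$ colors. * *$H$-freeness.* $G$ is $H$-free if there is no injective map $V(H)\to V(G)$ sending edges of $H$ to edges of $G$. * *Farness.* $G$ is $\varepsilon$-far from being $H$-free if more than $\varepsilon|V(G)|$ edges have to be deleted from or inserted into $G$ to obtain an $H$-free graph on the vertex set $V(G)$. * *Random neighbor model.* The vertex set of the input graph is $\{0,\dots,n-1\}$ and $n$ is known to the algorithm. The algorithm may toss coins (draw uniformly random numbers from finite ranges $\{0,\dots,k\}$). It accesses the edges only through random neighbor queries: given $v$, the oracle returns a uniformly random neighbor of $v$, independently of all previous answers, or reports that $v$ has no neighbor. Each next move is a computable function of $n$ and of the answers (of the coins and of the oracle) received so far. -/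

import Mathlib

open scoped ENNReal

/-! ### Graph classes, farness -/

/-- A class (or a property) of finite simple graphs. The vertex set of a graph with `n` vertices
is `{0, …, n - 1}`. No closure property (not even closure under isomorphism) is required. -/
abbrev GraphClass : Type := (n : ℕ) → Set (SimpleGraph (Fin n))

/-- The property of being `H`-free: there is no injective map `V(H) → V(G)` that sends edges to
edges (not necessarily induced). -/
def FreeOf {W : Type*} (H : SimpleGraph W) : GraphClass :=
  fun _ => {G | H.Free G}

/-- `G` is `ε`-far from `P`: every graph with property `P` on the same vertex set differs from `G`
by more than `ε * |G|` edge deletions and insertions. -/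
def IsFar (ε : ℝ) (P : GraphClass) {n : ℕ} (G : SimpleGraph (Fin n)) : Prop :=
  ∀ G' ∈ P n, ε * n < ((symmDiff G.edgeSet G'.edgeSet).ncard : ℝ)

/-! ### Treedepth and bounded expansion -/

/-- `r` is a tree order on `V`: a partial order in which the elements below any given element are
totally ordered. -/
structure IsTreeOrder {V : Type*} (r : V → V → Prop) : Prop where
  refl : ∀ v, r v v
  antisymm : ∀ u v, r u v → r v u → u = v
  trans : ∀ u v w, r u v → r v w → r u w
  total_below : ∀ v u w, r u v → r w v → r u w ∨ r w u

/-- A tree embedding of `G`: a tree order for which adjacent vertices are comparable. -/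
def IsTreeEmbedding {V : Type*} (G : SimpleGraph V) (r : V → V → Prop) : Prop :=
  IsTreeOrder r ∧ ∀ u v, G.Adj u v → r u v ∨ r v u

/-- The level of `v`: the number of elements strictly smaller than `v`; roots have level zero. -/
noncomputable def treeLevel {V : Type*} (r : V → V → Prop) (v : V) : ℕ :=
  {u | r u v ∧ u ≠ v}.ncard

/-- The treedepth of a finite graph: the least possible maximal level in a tree embedding. As roots
have level zero, an edgeless graph has treedepth `0` and a single edge has treedepth `1`. -/
noncomputable def treedepth {V : Type*} (G : SimpleGraph V) : ℕ :=
  sInf {d | ∃ r : V → V → Prop, IsTreeEmbedding G r ∧ ∀ v, treeLevel r v ≤ d}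

/-- `c` is a `p`-treedepth coloring of `G`: any `i ≤ p` color classes together induce a subgraph
of treedepth at most `i`. -/
def IsTreedepthColoring {V K : Type*} (p : ℕ) (G : SimpleGraph V) (c : V → K) : Prop :=
  ∀ S : Finset K, S.card ≤ p → treedepth (G.induce {v | c v ∈ S}) ≤ S.card

/-- Bounded expansion: for some function `f`, each graph of the class has, for every `p`, a
`p`-treedepth coloring with at most `f p` colors. -/
def HasBoundedExpansion (C : GraphClass) : Prop :=
  ∃ f : ℕ → ℕ, ∀ n, ∀ G ∈ C n, ∀ p : ℕ, ∃ c : Fin n → Fin (f p), IsTreedepthColoring p G c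

/-! ### Testers in the random neighbor model -/

/-- The possible moves of a tester:
* `inl k`: draw a uniformly random number from `{0, …, k}` (an internal coin toss);
* `inr (inl v)`: make a random neighbor query at the vertex `v`;
* `inr (inr b)`: stop, accepting if `b = true` and rejecting if `b = false`. -/
abbrev Move : Type := ℕ ⊕ ℕ ⊕ Bool

/-- A randomized oracle procedure: from the number of vertices of the input graph (that is, its
vertex set `{0, …, n - 1}`) and the list of all answers received so far, it determines its next
move. -/
abbrev Procedure : Type := ℕ × List (Option ℕ) → Move

open Classical in
/-- The answer to a random neighbor query at `v`: a uniformly random neighbor of `v`; the answer is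
`none` if there is no such neighbor. -/
noncomputable def randomNeighbor {n : ℕ} (G : SimpleGraph (Fin n)) (v : ℕ) : PMF (Option ℕ) :=
  if h : ∃ hv : v < n, (G.neighborFinset ⟨v, hv⟩).Nonempty then
    (PMF.uniformOfFinset _ h.choose_spec).map fun w : Fin n => some w.val
  else PMF.pure none

/-- One step of the procedure `T` on the input `G`. A state consists of the list of the answers
received so far, and of the number of oracle queries made so far. -/
noncomputable def step (T : Procedure) {n : ℕ} (G : SimpleGraph (Fin n))
    (s : List (Option ℕ) × ℕ) : PMF (List (Option ℕ) × ℕ) :=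
  match T (n, s.1) with
  | .inl k => (PMF.uniformOfFintype (Fin (k + 1))).map fun i : Fin (k + 1) => (s.1 ++ [some i.val], s.2)
  | .inr (.inl v) => (randomNeighbor G v).map fun a => (s.1 ++ [a], s.2 + 1)
  | .inr (.inr _) => PMF.pure s

/-- The law of the state of the procedure `T` on the input `G` after `t` steps. -/
noncomputable def run (T : Procedure) {n : ℕ} (G : SimpleGraph (Fin n)) :
    ℕ → PMF (List (Option ℕ) × ℕ)
  | 0 => PMF.pure ([], 0)
  | t + 1 => (run T G t).bind (step T G)

/-- The probability that `T` eventually stops on the input `G` with the verdict `b`: the supremum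
(which is the limit) over `t` of the probability that it has done so after `t` steps. -/
noncomputable def verdictProb (T : Procedure) {n : ℕ} (G : SimpleGraph (Fin n)) (b : Bool) : ℝ≥0∞ :=
  ⨆ t, ((run T G t).map fun s => T (n, s.1)) (.inr (.inr b))

/-- The probability that `T` accepts `G`. -/
noncomputable def acceptProb (T : Procedure) {n : ℕ} (G : SimpleGraph (Fin n)) : ℝ≥0∞ :=
  verdictProb T G true

/-- The probability that `T` rejects `G`. -/
noncomputable def rejectProb (T : Procedure) {n : ℕ} (G : SimpleGraph (Fin n)) : ℝ≥0∞ :=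
  verdictProb T G false

/-- `T` is an algorithm: its moves are computable, and on every input graph it reaches a verdict
with probability one. -/
def IsAlgorithm (T : Procedure) : Prop :=
  Computable T ∧ ∀ (n : ℕ) (G : SimpleGraph (Fin n)), acceptProb T G + rejectProb T G = 1

/-- `T` never makes more than `q` oracle queries, whatever the input graph is. -/
def HasQueryBound (T : Procedure) (q : ℕ) : Prop :=
  ∀ (n : ℕ) (G : SimpleGraph (Fin n)) (t : ℕ), ∀ s ∈ (run T G t).support, s.2 ≤ q

/-- `T` is a tester for the property `P` with proximity parameter `ε` on graphs of `C`. -/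
def IsTester (T : Procedure) (C P : GraphClass) (ε : ℝ) : Prop :=
  IsAlgorithm T ∧ ∀ n, ∀ G ∈ C n,
    (G ∈ P n → 2 / 3 ≤ acceptProb T G) ∧ (IsFar ε P G → 2 / 3 ≤ rejectProb T G)

/-- `T` has one-sided error for `P`: it accepts all graphs with property `P` with probability
one. -/
def HasOneSidedError (T : Procedure) (P : GraphClass) : Prop :=
  ∀ n, ∀ G ∈ P n, acceptProb T G = 1

/-! ### Tree orders -/

/-! The tester looks for a copy of `H` by random neighbor queries and rejects only if it has seen
all edges of a copy, so one-sided error is immediate. The point is that a far graph of the class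
reveals a copy with probability bounded away from zero.

Color `G` so that any few colors induce a graph of small treedepth. A copy of `H` uses at most
|V(H)| colors and there are boundedly many sets of colors, so it suffices to clean each of the
induced subgraphs by deleting few edges: farness leaves a copy in one of the cleaned subgraphs
(`HasBoundedExpansion.exists_clean`). The tree orders also make the degree sum of `G` linear
(`sum_degree_le_of_isTreedepthColoring`). Hence there is a threshold `K` such that few edges meet
vertices of degree moderately larger than `K`; all other vertices are low (degree at most `K`) or of
much higher degree, and then rare.

Cleaning has two stages. As the high vertices are rare, few deletions ensure that high vertices are
joined to low vertices only, and never to vertices below them, and that the high vertices around a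
connected low part form a chain of the tree order (`exists_separated`). Next, whenever a copy uses
an edge from a high vertex `a` to a low vertex, a positive proportion of all neighbors of `a` in `G`
shall be able to play the same role, in a copy that is changed only on one component of the part not
mapped below `a` (`exists_many_alternatives`). Where this fails, the few alternatives are cut off
from `a`. A potential bounds the total cost: the minimal weight of a family of partial maps covering
the copies at `a` is bounded independently of the graph, and gluing two copies (`IsEmb.glue`) shows
that it falls with every cut.

In a clean graph a copy is explored edge by edge (`Explorable.progress`). At a low vertex the wanted
edge is one of at most `K`. Once the edges at discovered low vertices are known, an undiscovered
component of `H` is attached to a chain of high vertices; a random neighbor of the topmost one is an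
alternative with positive probability, and the copy is rerouted through it (`Exploration.reroute`).
A component attached to nothing discovered is entered at a random vertex, a virtual root taking the
place of `a`. So |E(H)| lucky queries reveal a copy, and repeated rounds raise the probability to
2/3. -/

theorem exists_treeEmbedding_level_le {V : Type*} [Finite V] (G : SimpleGraph V) :
    ∃ r : V → V → Prop, IsTreeEmbedding G r ∧ ∀ v, treeLevel r v ≤ treedepth G := by
  have hne : {d | ∃ r : V → V → Prop, IsTreeEmbedding G r ∧ ∀ v, treeLevel r v ≤ d}.Nonempty := by
    -- Any linear order is a tree embedding, so the infimum runs over a nonempty set and is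
    -- attained.
    obtain ⟨n, ⟨e⟩⟩ := Finite.exists_equiv_fin V
    refine ⟨Nat.card V, fun u v => e u ≤ e v, ⟨⟨fun v => le_rfl, fun u v h1 h2 => ?_,
      fun u v w => le_trans, fun v u w _ _ => le_total _ _⟩, fun u v _ => le_total _ _⟩, fun v => ?_⟩
    · exact e.injective (le_antisymm h1 h2)
    · exact (Set.ncard_le_ncard (Set.subset_univ _) Set.finite_univ).trans (Set.ncard_univ V).le
  exact Nat.sInf_mem hne

/-- The subgraph of `G` formed by the edges with both ends in `S`, on the same vertex set. -/
def within {V : Type*} (G : SimpleGraph V) (S : Set V) : SimpleGraph V where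
  Adj x y := G.Adj x y ∧ x ∈ S ∧ y ∈ S
  symm := ⟨fun _ _ h => ⟨h.1.symm, h.2.2, h.2.1⟩⟩
  loopless := ⟨fun _ h => h.1.ne rfl⟩

theorem within_le {V : Type*} (G : SimpleGraph V) (S : Set V) : within G S ≤ G :=
  fun _ _ h => h.1

/-- Vertices outside `S` become isolated roots of level zero. Keeping the vertex set fixed allows
the orders for different color sets to be used side by side. -/
theorem exists_treeEmbedding_within {V : Type*} [Finite V] (G : SimpleGraph V) (S : Set V) (d : ℕ)
    (hd : treedepth (G.induce S) ≤ d) :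
    ∃ r : V → V → Prop, IsTreeEmbedding (within G S) r ∧ ∀ v, treeLevel r v ≤ d := by
  obtain ⟨r, ⟨hr, hadj⟩, hl⟩ := exists_treeEmbedding_level_le (G.induce S)
  refine ⟨fun u v => u = v ∨ ∃ (hu : u ∈ S) (hv : v ∈ S), r ⟨u, hu⟩ ⟨v, hv⟩,
    ⟨⟨fun v => Or.inl rfl, ?_, ?_, ?_⟩, ?_⟩, ?_⟩
  · rintro u v (h | ⟨hu, hv, h⟩) (h' | ⟨hv', hu', h'⟩)
    · exact h
    · exact h
    · exact h'.symm
    · exact congrArg Subtype.val (hr.antisymm _ _ h h')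
  · rintro u v w (rfl | ⟨hu, hv, h⟩) (rfl | ⟨hv', hw, h'⟩)
    · exact Or.inl rfl
    · exact Or.inr ⟨_, _, h'⟩
    · exact Or.inr ⟨_, _, h⟩
    · exact Or.inr ⟨hu, hw, hr.trans _ _ _ h h'⟩
  · rintro v u w (rfl | ⟨hu, hv, h⟩) (rfl | ⟨hw, hv', h'⟩)
    · exact Or.inl (Or.inl rfl)
    · exact Or.inr (Or.inr ⟨_, _, h'⟩)
    · exact Or.inl (Or.inr ⟨_, _, h⟩)
    · exact (hr.total_below _ _ _ h h').imp (fun h => Or.inr ⟨_, _, h⟩) (fun h => Or.inr ⟨_, _, h⟩)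
  · rintro u v ⟨h, hu, hv⟩
    exact (hadj ⟨u, hu⟩ ⟨v, hv⟩ h).imp (fun h => Or.inr ⟨_, _, h⟩) (fun h => Or.inr ⟨_, _, h⟩)
  · intro v
    by_cases hv : v ∈ S
    · refine le_trans ?_ ((hl ⟨v, hv⟩).trans hd)
      unfold treeLevel
      rw [← Set.ncard_image_of_injective _ (Subtype.val_injective (p := (· ∈ S)))]
      refine Set.ncard_le_ncard ?_ (Set.toFinite _)
      rintro u ⟨rfl | ⟨hu, _, h⟩, hne⟩
      · exact absurd rfl hne
      · exact ⟨⟨u, hu⟩, ⟨h, fun h => hne (congrArg Subtype.val h)⟩, rfl⟩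
    · unfold treeLevel
      rw [Set.ncard_eq_zero (Set.toFinite _) |>.2]
      · exact Nat.zero_le _
      · ext u
        simp only [Set.mem_ofPred_eq, Set.mem_empty_iff_false, iff_false, not_and, not_not]
        rintro (h | ⟨_, hv', _⟩)
        · exact h
        · exact absurd hv' hv

open Classical in
/-- The degree sum of a graph with a `2`-treedepth coloring is linear in the number of vertices. -/
theorem sum_degree_le_of_isTreedepthColoring {n k p : ℕ} (hp : 2 ≤ p) (G : SimpleGraph (Fin n))
    (c : Fin n → Fin k) (hc : IsTreedepthColoring p G c) :
    ∑ v, G.degree v ≤ 2 * 2 ^ k * p * n := by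
  have hS : ∀ S : Finset (Fin k), ∃ r : Fin n → Fin n → Prop, (∀ v, treeLevel r v ≤ p) ∧
      (S.card ≤ p → ∀ u v, G.Adj u v → c u ∈ S → c v ∈ S → r u v ∨ r v u) := by
    intro S
    by_cases h : S.card ≤ p
    · obtain ⟨r, hr, hl⟩ := exists_treeEmbedding_within G {v | c v ∈ S} p ((hc S h).trans h)
      exact ⟨r, hl, fun _ u v huv hu hv => hr.2 u v ⟨huv, hu, hv⟩⟩
    -- A default that makes `choose` applicable; all its levels are zero.
    · refine ⟨fun _ _ => False, fun v => ?_, fun h' => absurd h' h⟩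
      simp [treeLevel]
  choose r hl hr using hS
  let B : Fin n → Finset (Fin n) := fun v =>
    Finset.univ.biUnion fun S => Finset.univ.filter fun u => r S u v ∧ u ≠ v
  have hB : ∀ v, (B v).card ≤ 2 ^ k * p := by
    intro v
    refine Finset.card_biUnion_le.trans ?_
    calc _ ≤ ∑ S : Finset (Fin k), p := by
            refine Finset.sum_le_sum fun S _ => ?_
            refine le_trans (le_of_eq ?_) (hl S v)
            unfold treeLevel
            rw [Set.ncard_eq_toFinset_card']
            congr 1
            ext; simp
      _ = _ := by simp
  have hsub : ∀ u v, G.Adj u v → u ∈ B v ∨ v ∈ B u := by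
    intro u v huv
    -- Two colors suffice to make the ends of an edge comparable, so each edge is charged to its
    -- upper end in one of the `2 ^ k` orders.
    have h2 : ({c u, c v} : Finset (Fin k)).card ≤ p := Finset.card_le_two.trans hp
    rcases hr _ h2 u v huv (by simp) (by simp) with h | h
    · left
      simp only [B, Finset.mem_biUnion, Finset.mem_filter, Finset.mem_univ, true_and]
      exact ⟨_, h, huv.ne⟩
    · right
      simp only [B, Finset.mem_biUnion, Finset.mem_filter, Finset.mem_univ, true_and]
      exact ⟨_, h, huv.ne'⟩
  have hdeg : ∀ v, G.degree v ≤ (B v).card + (Finset.univ.filter fun u => v ∈ B u).card := by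
    intro v
    rw [← SimpleGraph.card_neighborFinset_eq_degree]
    refine le_trans (Finset.card_le_card ?_) (Finset.card_union_le _ _)
    intro u hu
    rw [SimpleGraph.mem_neighborFinset] at hu
    rcases hsub v u hu with h | h
    · exact Finset.mem_union_right _ (by simpa using h)
    · exact Finset.mem_union_left _ h
  have hdc : ∑ v, (Finset.univ.filter fun u => v ∈ B u).card = ∑ u, (B u).card := by
    simp only [Finset.card_filter]
    rw [Finset.sum_comm]
    refine Finset.sum_congr rfl fun u _ => ?_
    simp
  calc ∑ v, G.degree v ≤ ∑ v, ((B v).card + (Finset.univ.filter fun u => v ∈ B u).card) :=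
        Finset.sum_le_sum fun v _ => hdeg v
    _ = ∑ v, (B v).card + ∑ v, (B v).card := by rw [Finset.sum_add_distrib, hdc]
    _ ≤ ∑ _v : Fin n, 2 ^ k * p + ∑ _v : Fin n, 2 ^ k * p :=
        Nat.add_le_add (Finset.sum_le_sum fun v _ => hB v) (Finset.sum_le_sum fun v _ => hB v)
    _ = _ := by simp; ring

/-! ### Separating the vertices of high degree -/

section Separation

variable {V : Type*}

/-- Prepend `x` to a walk that starts at `x'` and has least vertex `m`. If `x` is below `x'`, then
`x` and `m` are both below `x'`, hence comparable; if `x'` is below `x`, then so is `m`. -/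
theorem IsTreeOrder.exists_least_of_walk {r : V → V → Prop} (hr : IsTreeOrder r)
    {G : SimpleGraph V} (hG : ∀ u v, G.Adj u v → r u v ∨ r v u) {x y : V} (w : G.Walk x y) :
    ∃ m ∈ w.support, ∀ z ∈ w.support, r m z := by
  induction w with
  | @nil u => exact ⟨u, by simp, by simp [hr.refl]⟩
  | @cons x x' y h w ih =>
    obtain ⟨m, hm, hmin⟩ := ih
    have hx' := hmin x' w.start_mem_support
    have hcase : r x m ∨ r m x := by
      rcases hG _ _ h with h | h
      · exact hr.total_below _ _ _ h hx'
      · exact Or.inr (hr.trans _ _ _ hx' h)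
    simp only [SimpleGraph.Walk.support_cons, List.mem_cons]
    rcases hcase with h | h
    · refine ⟨x, Or.inl rfl, ?_⟩
      rintro z (rfl | hz)
      · exact hr.refl _
      · exact hr.trans _ _ _ h (hmin z hz)
    · refine ⟨m, Or.inr hm, ?_⟩
      rintro z (rfl | hz)
      · exact h
      · exact hmin z hz

open Classical in
/-- The vertices that can be reached from `m` by a walk of length at most `k` all whose vertices,
except possibly the last one, lie in `low`. -/
noncomputable def lowBall [Fintype V] (G : SimpleGraph V) (low : Set V) : ℕ → V → Finset V
  | 0, m => {m}
  | k + 1, m => if m ∈ low then {m} ∪ (G.neighborFinset m).biUnion (lowBall G low k) else {m}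

open Classical in
theorem card_lowBall_le [Fintype V] (G : SimpleGraph V) (low : Set V) (K : ℕ)
    (hK : ∀ v ∈ low, G.degree v ≤ K) (k : ℕ) (m : V) :
    (lowBall G low k m).card ≤ (K + 1) ^ k := by
  induction k generalizing m with
  | zero => simp [lowBall]
  | succ k ih =>
    rw [lowBall]
    split_ifs with h
    · calc _ ≤ 1 + ((G.neighborFinset m).biUnion (lowBall G low k)).card :=
            Finset.card_union_le _ _
        _ ≤ 1 + ∑ v ∈ G.neighborFinset m, (K + 1) ^ k :=
            Nat.add_le_add_left (Finset.card_biUnion_le.trans (Finset.sum_le_sum fun v _ => ih v)) 1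
        _ = 1 + G.degree m * (K + 1) ^ k := by simp
        _ ≤ (K + 1) ^ k + K * (K + 1) ^ k :=
            Nat.add_le_add (Nat.one_le_pow _ _ (by omega)) (Nat.mul_le_mul_right _ (hK m h))
        _ = _ := by ring
    · simpa using Nat.one_le_pow _ _ (by omega)

theorem mem_lowBall_of_walk [Fintype V] (G : SimpleGraph V) (low : Set V) {m x : V}
    (w : (within G low).Walk m x) (k : ℕ) (hk : w.length ≤ k) : x ∈ lowBall G low k m := by
  classical
  induction w generalizing k with
  | nil => cases k <;> simp [lowBall]; split_ifs <;> simp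
  | @cons m m' x h w ih =>
    rw [SimpleGraph.Walk.length_cons] at hk
    obtain ⟨k, rfl⟩ := Nat.exists_eq_add_of_le' (Nat.one_le_of_lt hk)
    rw [lowBall, if_pos h.2.1]
    refine Finset.mem_union_right _ (Finset.mem_biUnion.2 ⟨m', ?_, ih k (by omega)⟩)
    simpa using h.1

/-- Every edge of `G` has an end in `low`, vertices outside `low` have no neighbors below them, and
the neighbors outside `low` of a connected part of `low` form a chain. -/
structure Separated (G : SimpleGraph V) (r : V → V → Prop) (low : Set V) (L : ℕ) : Prop where
  low_or : ∀ u v, G.Adj u v → u ∈ low ∨ v ∈ low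
  up : ∀ a x, a ∉ low → G.Adj a x → ¬ r x a
  chain : ∀ x y, x ∈ low → ∀ w : (within G low).Walk x y, w.length ≤ L →
    ∀ a b, a ∉ low → b ∉ low → G.Adj a x → G.Adj b y → r a b ∨ r b a

theorem Separated.anti {G G' : SimpleGraph V} {r : V → V → Prop} {low : Set V} {L : ℕ}
    (h : Separated G r low L) (hle : G' ≤ G) : Separated G' r low L where
  low_or u v huv := h.low_or u v (hle huv)
  up a x ha hx := h.up a x ha (hle hx)
  chain x y hx w hw a b ha hb hax hby := by
    have hle' : within G' low ≤ within G low := fun u v huv => ⟨hle huv.1, huv.2⟩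
    exact h.chain x y hx (w.mapLe hle') (by simpa using hw) a b ha hb (hle hax) (hle hby)

open Classical in
/-- By deleting few edges, the vertices of degree more than `K` can be separated. The price depends
on the number of vertices of degree more than `K'`, and on the edges at vertices with degrees
in between. -/
theorem exists_separated [Fintype V] (G G₀ : SimpleGraph V) (hle : G₀ ≤ G) (r : V → V → Prop)
    (hr : IsTreeOrder r) (hemb : ∀ u v, G₀.Adj u v → r u v ∨ r v u) (d : ℕ)
    (hd : ∀ v, treeLevel r v ≤ d) (K K' L : ℕ) :
    ∃ G₁ ≤ G₀, (G₀.edgeSet \ G₁.edgeSet).ncard ≤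
        ∑ u with K < G.degree u ∧ G.degree u ≤ K', G.degree u +
          (Finset.univ.filter fun u => K' < G.degree u).card * (d + d * (K + 1) ^ L) ∧
      Separated G₁ r {v | G.degree v ≤ K} L ∧
      ∀ u v, G₁.Adj u v → G.degree u ≤ K ∨ K' < G.degree u := by
  set low : Set V := {v | G.degree v ≤ K} with hlow
  have hdeg : ∀ v, G₀.degree v ≤ G.degree v := fun v => SimpleGraph.degree_le_of_le hle
  -- The three reasons to delete an edge from a high `u` to `v` serve different conclusions:
  -- intermediate degree of `u` creates the gap, `v` below `u` gives `low_or` and `up`, and `v`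
  -- close to a low `m` below `u` gives `chain`. As at most `d` vertices are strictly below `u`, the
  -- last two concern at most `d + d * (K + 1) ^ L` vertices `v`.
  let bad : V → V → Prop := fun u v => K < G.degree u ∧ (G.degree u ≤ K' ∨ r v u ∨
    ∃ m, m ∈ low ∧ r m u ∧ v ∈ lowBall G₀ low L m)
  let G₁ : SimpleGraph V :=
    { Adj := fun u v => G₀.Adj u v ∧ ¬ bad u v ∧ ¬ bad v u
      symm := ⟨fun _ _ h => ⟨h.1.symm, h.2.2, h.2.1⟩⟩
      loopless := ⟨fun _ h => h.1.ne rfl⟩ }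
  have hnl : ∀ a, a ∉ low → K < G.degree a := fun a ha => not_le.1 ha
  refine ⟨G₁, fun u v h => h.1, ?_, ⟨?_, ?_, ?_⟩, ?_⟩
  · let N : V → Finset V := fun u => (G₀.neighborFinset u).filter fun v => bad u v
    let D : Finset (Sym2 V) := Finset.univ.biUnion fun u => (N u).image fun v => s(u, v)
    have hsub : G₀.edgeSet \ G₁.edgeSet ⊆ D := by
      intro e
      induction e with
      | _ u v =>
        rintro ⟨h0, h1⟩
        rw [SimpleGraph.mem_edgeSet] at h0 h1
        have : bad u v ∨ bad v u := by
          by_contra hcon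
          push Not at hcon
          exact h1 ⟨h0, hcon⟩
        simp only [D, N, Finset.coe_biUnion, Set.mem_iUnion, Finset.coe_image, Set.mem_image,
          Finset.coe_filter, SimpleGraph.mem_neighborFinset]
        rcases this with h | h
        · exact ⟨u, by simp, v, ⟨h0, h⟩, rfl⟩
        · exact ⟨v, by simp, u, ⟨h0.symm, h⟩, Sym2.eq_swap⟩
    have hN : ∀ u, (N u).card ≤ (if K < G.degree u ∧ G.degree u ≤ K' then G.degree u else 0) +
        (if K' < G.degree u then d + d * (K + 1) ^ L else 0) := by
      intro u
      have hNd : (N u).card ≤ G.degree u := by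
        refine (Finset.card_le_card (Finset.filter_subset _ _)).trans ?_
        rw [SimpleGraph.card_neighborFinset_eq_degree]
        exact hdeg u
      by_cases h1 : K < G.degree u
      · by_cases h2 : G.degree u ≤ K'
        · rw [if_pos ⟨h1, h2⟩]; omega
        · rw [if_neg (fun h => h2 h.2), if_pos (not_le.1 h2), zero_add]
          let B : Finset V := Finset.univ.filter fun v => r v u ∧ v ≠ u
          have hB : B.card ≤ d := by
            refine le_trans (le_of_eq ?_) (hd u)
            unfold treeLevel
            rw [Set.ncard_eq_toFinset_card']
            congr 1
            ext; simp [B]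
          have hNB : N u ⊆ B ∪ (B.filter (· ∈ low)).biUnion (lowBall G₀ low L) := by
            intro v hv
            simp only [N, Finset.mem_filter, SimpleGraph.mem_neighborFinset] at hv
            obtain ⟨hadj, -, h | h | ⟨m, hm, hmu, hv⟩⟩ := hv
            · exact absurd h h2
            · exact Finset.mem_union_left _ (by simp [B, h, hadj.ne'])
            · refine Finset.mem_union_right _ (Finset.mem_biUnion.2 ⟨m, ?_, hv⟩)
              have : m ≠ u := by
                rintro rfl
                exact absurd hm (not_le.2 h1)
              simp [B, hmu, this, hm]
          calc _ ≤ _ := Finset.card_le_card hNB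
            _ ≤ B.card + ∑ m ∈ B.filter (· ∈ low), (lowBall G₀ low L m).card :=
              (Finset.card_union_le _ _).trans (Nat.add_le_add_left Finset.card_biUnion_le _)
            _ ≤ B.card + ∑ m ∈ B.filter (· ∈ low), (K + 1) ^ L :=
              Nat.add_le_add_left (Finset.sum_le_sum fun m _ =>
                card_lowBall_le _ _ _ (fun v hv => (hdeg v).trans hv) _ _) _
            _ ≤ d + d * (K + 1) ^ L := by
              rw [Finset.sum_const, smul_eq_mul]
              exact Nat.add_le_add hB (Nat.mul_le_mul_right _
                ((Finset.card_le_card (Finset.filter_subset _ _)).trans hB))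
      · have : N u = ∅ := by
          ext v
          simp [N, bad, h1]
        simp [this]
    calc _ ≤ (D : Set (Sym2 V)).ncard := Set.ncard_le_ncard hsub (Finset.finite_toSet _)
      _ = D.card := Set.ncard_coe_finset _
      _ ≤ ∑ u, (N u).card := Finset.card_biUnion_le.trans
          (Finset.sum_le_sum fun u _ => Finset.card_image_le)
      _ ≤ _ := Finset.sum_le_sum fun u _ => hN u
      _ = _ := by
        rw [Finset.sum_add_distrib, Finset.sum_filter, ← Finset.sum_filter (fun u => K' < G.degree u),
          Finset.sum_const, smul_eq_mul]
  · intro u v huv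
    by_contra hcon
    push Not at hcon
    rcases hemb u v huv.1 with h | h
    · exact huv.2.2 ⟨hnl _ hcon.2, Or.inr (Or.inl h)⟩
    · exact huv.2.1 ⟨hnl _ hcon.1, Or.inr (Or.inl h)⟩
  · intro a x ha hax h
    exact hax.2.1 ⟨hnl _ ha, Or.inr (Or.inl h)⟩
  · intro x y hx w hw a b ha hb hax hby
    have hle1 : within G₁ low ≤ within G₀ low := fun u v huv => ⟨huv.1.1, huv.2⟩
    have hy : y ∈ low := by
      cases w.reverse with
      | nil => exact hx
      | cons h _ => exact h.2.1
    obtain ⟨m, hm, hmin⟩ := hr.exists_least_of_walk (G := within G₀ low) (fun u v huv => hemb u v huv.1)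
      (w.mapLe hle1)
    have hlen : (w.mapLe hle1).length ≤ L := by simpa using hw
    set w' := w.mapLe hle1 with hw'
    have hmlow : m ∈ low := by
      cases w'.dropUntil m hm with
      | nil => exact hy
      | cons h _ => exact h.2.1
    -- A high neighbor `c` of an end `z` lies below `z`, as does the least vertex `m` of the walk,
    -- so they are comparable. If `m` were below `c`, the edge from `c` to `z` would be bad, since
    -- `z` lies in the ball around `m`. Thus `a` and `b` both lie below `m`.
    have key : ∀ c z, c ∉ low → G₁.Adj c z → r m z → (∃ q : (within G₀ low).Walk m z, q.length ≤ L) →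
        r c m := by
      rintro c z hc hcz hmz ⟨q, hq⟩
      have hcz' : r c z := (hemb _ _ hcz.1).resolve_right fun h =>
        hcz.2.1 ⟨hnl _ hc, Or.inr (Or.inl h)⟩
      refine (hr.total_below _ _ _ hcz' hmz).resolve_right fun h => ?_
      exact hcz.2.1 ⟨hnl _ hc, Or.inr (Or.inr ⟨m, hmlow, h, mem_lowBall_of_walk _ _ q L hq⟩)⟩
    have h1 := key a x ha hax (hmin x w'.start_mem_support)
      ⟨(w'.takeUntil m hm).reverse, by
        rw [SimpleGraph.Walk.length_reverse]
        exact (w'.length_takeUntil_le_length hm).trans hlen⟩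
    have h2 := key b y hb hby (hmin y w'.end_mem_support)
      ⟨w'.dropUntil m hm, (w'.length_dropUntil_le_length hm).trans hlen⟩
    exact hr.total_below _ _ _ h1 h2
  · intro u v huv
    by_contra hcon
    push Not at hcon
    exact huv.2.1 ⟨hcon.1, Or.inl hcon.2⟩

end Separation

/-! ### Embeddings and their covers by partial maps -/

section Covers

variable {V W : Type*}

/-- `φ` embeds `H` into `G` as a (not necessarily induced) subgraph. -/
structure IsEmb (H : SimpleGraph W) (G : SimpleGraph V) (φ : W → V) : Prop where
  inj : Function.Injective φ
  adj : ∀ p q, H.Adj p q → G.Adj (φ p) (φ q)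

theorem IsEmb.mono {H : SimpleGraph W} {G G' : SimpleGraph V} {φ : W → V} (h : IsEmb H G φ)
    (hle : G ≤ G') : IsEmb H G' φ :=
  ⟨h.inj, fun p q hpq => hle (h.adj p q hpq)⟩

theorem mem_of_reachable_within {G : SimpleGraph V} {S : Set V} {x y : V}
    (h : (within G S).Reachable x y) (hx : x ∈ S) : y ∈ S := by
  obtain ⟨w⟩ := h
  cases w.reverse with
  | nil => exact hx
  | cons h _ => exact h.2.1

-- An edge of `H` leaving the component of `q` outside `U` ends in `U`, where the two maps agree.
-- Injectivity can fail only between values of `φ'` and of `φ`, and outside `U` these are disjoint.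
open Classical in
theorem IsEmb.glue {H : SimpleGraph W} {G : SimpleGraph V} {φ φ' : W → V} (hφ : IsEmb H G φ)
    (hφ' : IsEmb H G φ') (U : Set W) (hU : ∀ u ∈ U, φ' u = φ u)
    (hdisj : ∀ w ∉ U, ∀ w' ∉ U, φ' w ≠ φ w') (q : W) (hq : q ∉ U) :
    IsEmb H G (fun x => if (within H Uᶜ).Reachable q x then φ' x else φ x) := by
  have hmem : ∀ x, (within H Uᶜ).Reachable q x → x ∉ U := fun x hx => mem_of_reachable_within hx hq
  have hcross : ∀ x y, (within H Uᶜ).Reachable q x → ¬ (within H Uᶜ).Reachable q y →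
      φ' x ≠ φ y := by
    intro x y hx hy h
    by_cases hyU : y ∈ U
    · rw [← hU y hyU] at h
      exact hy (hφ'.inj h ▸ hx)
    · exact hdisj x (hmem x hx) y hyU h
  have hadj : ∀ x y, (within H Uᶜ).Reachable q x → ¬ (within H Uᶜ).Reachable q y →
      H.Adj x y → φ' y = φ y := by
    intro x y hx hy h
    by_contra hne
    have hyU : y ∉ U := fun hyU => hne (hU y hyU)
    exact hy (hx.trans (SimpleGraph.Adj.reachable ⟨h, hmem x hx, hyU⟩))
  refine ⟨fun x y hxy => ?_, fun x y hxy => ?_⟩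
  · split_ifs at hxy with hx hy hy
    · exact hφ'.inj hxy
    · exact absurd hxy (hcross x y hx hy)
    · exact absurd hxy.symm (hcross y x hy hx)
    · exact hφ.inj hxy
  · split_ifs with hx hy hy
    · exact hφ'.adj x y hxy
    · rw [← hadj x y hx hy hxy]; exact hφ'.adj x y hxy
    · rw [← hadj y x hy hx hxy.symm]; exact hφ'.adj x y hxy
    · exact hφ.adj x y hxy

/-- The vertices below `a`, including `a`; here `none` is a virtual root below all vertices. -/
def below (r : V → V → Prop) : Option V → Set V
  | none => ∅
  | some a => {u | r u a}

/-- The vertices adjacent to `a`; for the virtual root, these are all non-isolated vertices. -/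
def attached (G : SimpleGraph V) : Option V → Set V
  | none => {y | ∃ z, G.Adj y z}
  | some a => {y | G.Adj a y}

theorem attached_mono {G G' : SimpleGraph V} (h : G ≤ G') (a : Option V) :
    attached G a ⊆ attached G' a := by
  cases a with
  | none => exact fun y ⟨z, hz⟩ => ⟨z, h hz⟩
  | some a => exact fun y hy => h hy

/-- The embeddings of `H` into `G` that map `q` to a vertex of `low` attached to `a`. -/
def embsAt (H : SimpleGraph W) (G : SimpleGraph V) (r : V → V → Prop) (low : Set V)
    (a : Option V) (q : W) : Set (W → V) :=
  {φ | IsEmb H G φ ∧ φ q ∈ low ∧ φ q ∈ attached G a ∧ φ q ∉ below r a}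

theorem embsAt_mono {H : SimpleGraph W} {G G' : SimpleGraph V} (h : G ≤ G') (r : V → V → Prop)
    (low : Set V) (a : Option V) (q : W) : embsAt H G r low a q ⊆ embsAt H G' r low a q :=
  fun _ hφ => ⟨hφ.1.mono h, hφ.2.1, attached_mono h a hφ.2.2.1, hφ.2.2.2⟩

/-- The images of `q` under the embeddings of `H` that differ from `φ` only on the component of `q`
in the part of `H` that `φ` does not map below `a`. -/
def alternatives (H : SimpleGraph W) (G : SimpleGraph V) (r : V → V → Prop) (low : Set V)
    (a : Option V) (q : W) (φ : W → V) : Set V :=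
  {y | ∃ φ' ∈ embsAt H G r low a q, φ' q = y ∧
    ∀ x, ¬ (within H (φ ⁻¹' below r a)ᶜ).Reachable q x → φ' x = φ x}

/-! ### Covers by partial maps and their weights -/

/-- Every map in `Φ` extends one of the partial maps in `P` whose domain contains all that is mapped
below `a`, but not `q`. -/
structure IsCover (r : V → V → Prop) (a : Option V) (q : W) (Φ : Set (W → V))
    (P : Finset (W → Option V)) : Prop where
  none_at : ∀ σ ∈ P, σ q = none
  cover : ∀ φ ∈ Φ, ∃ σ ∈ P, (∀ w v, σ w = some v → φ w = v) ∧
    ∀ w, φ w ∈ below r a → σ w ≠ none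

variable [Fintype W]

open Classical in
/-- The number of elements at which a partial map is not defined. -/
noncomputable def undefCard (σ : W → Option V) : ℕ :=
  (Finset.univ.filter fun w => σ w = none).card

/-- The weight of a set of partial maps: smaller domains weigh more. -/
noncomputable def coverWeight (P : Finset (W → Option V)) : ℕ :=
  ∑ σ ∈ P, (Fintype.card W ^ 2 + 1) ^ undefCard σ

/-- The minimal weight of a cover. -/
noncomputable def coverNumber (r : V → V → Prop) (a : Option V) (q : W) (Φ : Set (W → V)) : ℕ :=
  sInf {m | ∃ P, IsCover r a q Φ P ∧ coverWeight P = m}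

theorem undefCard_le (σ : W → Option V) : undefCard σ ≤ Fintype.card W :=
  Finset.card_le_univ _

/-- Restricting each map to what it sends below `a` gives a cover by partial maps with at most `d +
1` possible values, `none` included, at each vertex. The bound does not depend on the size of the
graph, which makes the cover number usable as a potential. -/
theorem exists_isCover [Fintype V] (r : V → V → Prop) (a : Option V) (q : W) (Φ : Set (W → V))
    (hΦ : ∀ φ ∈ Φ, φ q ∉ below r a) (d : ℕ) (hd : (below r a).ncard ≤ d) :
    ∃ P, IsCover r a q Φ P ∧ coverWeight P ≤
      (d + 1) ^ Fintype.card W * (Fintype.card W ^ 2 + 1) ^ Fintype.card W := by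
  classical
  let B : W → Finset (Option V) := fun w =>
    if w = q then {none} else Finset.insertNone (below r a).toFinset
  have hB : ∀ w, (B w).card ≤ d + 1 := by
    intro w
    dsimp only [B]
    split_ifs
    · simp
    · rw [Finset.card_insertNone, ← Set.ncard_eq_toFinset_card']
      omega
  refine ⟨Fintype.piFinset B, ⟨fun σ hσ => ?_, fun φ hφ => ?_⟩, ?_⟩
  · have := Fintype.mem_piFinset.1 hσ q
    simpa [B] using this
  · refine ⟨fun w => if φ w ∈ below r a then some (φ w) else none, ?_, ?_, ?_⟩
    · refine Fintype.mem_piFinset.2 fun w => ?_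
      dsimp only [B]
      split_ifs with h1 h2 h2
      · exact absurd (h1 ▸ h2) (hΦ φ hφ)
      · simp
      · simpa using h2
      · simp
    · intro w v h
      dsimp only at h
      split_ifs at h with h1
      exact Option.some.inj h
    · intro w hw
      simp [hw]
  · calc _ ≤ ∑ σ ∈ Fintype.piFinset B, (Fintype.card W ^ 2 + 1) ^ Fintype.card W :=
          Finset.sum_le_sum fun σ _ => Nat.pow_le_pow_right (by omega) (undefCard_le σ)
      _ = (∏ w, (B w).card) * (Fintype.card W ^ 2 + 1) ^ Fintype.card W := by
          rw [Finset.sum_const, smul_eq_mul, Fintype.card_piFinset]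
      _ ≤ _ := by
          refine Nat.mul_le_mul_right _ ?_
          exact (Finset.prod_le_prod' fun w _ => hB w).trans (by simp)

theorem IsCover.coverNumber_le {r : V → V → Prop} {a : Option V} {q : W} {Φ : Set (W → V)}
    {P : Finset (W → Option V)} (h : IsCover r a q Φ P) : coverNumber r a q Φ ≤ coverWeight P :=
  Nat.sInf_le ⟨P, h, rfl⟩

theorem coverNumber_le [Fintype V] (r : V → V → Prop) (a : Option V) (q : W) (Φ : Set (W → V))
    (hΦ : ∀ φ ∈ Φ, φ q ∉ below r a) (d : ℕ) (hd : (below r a).ncard ≤ d) :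
    coverNumber r a q Φ ≤
      (d + 1) ^ Fintype.card W * (Fintype.card W ^ 2 + 1) ^ Fintype.card W := by
  obtain ⟨P, hP, hw⟩ := exists_isCover r a q Φ hΦ d hd
  exact hP.coverNumber_le.trans hw

theorem exists_minimal_cover [Fintype V] (r : V → V → Prop) (a : Option V) (q : W)
    (Φ : Set (W → V)) (hΦ : ∀ φ ∈ Φ, φ q ∉ below r a) :
    ∃ P, IsCover r a q Φ P ∧ coverWeight P = coverNumber r a q Φ := by
  obtain ⟨P, hP, -⟩ := exists_isCover r a q Φ hΦ _ le_rfl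
  exact Nat.sInf_mem (s := {m | ∃ P, IsCover r a q Φ P ∧ coverWeight P = m}) ⟨_, P, hP, rfl⟩

theorem coverNumber_mono [Fintype V] (r : V → V → Prop) (a : Option V) (q : W)
    {Φ Φ' : Set (W → V)} (h : Φ ⊆ Φ') (hΦ : ∀ φ ∈ Φ', φ q ∉ below r a) :
    coverNumber r a q Φ ≤ coverNumber r a q Φ' := by
  obtain ⟨P, hP, hw⟩ := exists_minimal_cover r a q Φ' hΦ
  have hP' : IsCover r a q Φ P := ⟨hP.none_at, fun φ hφ => hP.cover φ (h hφ)⟩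
  exact hP'.coverNumber_le.trans hw.le

open Classical in
/-- Refining one member of a cover, if all maps of a smaller family that extend it meet a small set
`Z` of vertices in addition. -/
theorem coverNumber_lt_of_refine {r : V → V → Prop} {a : Option V} {q : W}
    {Φ Φ' : Set (W → V)} (hsub : Φ' ⊆ Φ) {P : Finset (W → Option V)} (hP : IsCover r a q Φ P)
    {σ : W → Option V} (hσ : σ ∈ P) (Z : Finset V) (hZ : Z.card ≤ Fintype.card W)
    (hhit : ∀ φ ∈ Φ', (∀ w v, σ w = some v → φ w = v) → (∀ w, φ w ∈ below r a → σ w ≠ none) →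
      ∃ w, σ w = none ∧ w ≠ q ∧ φ w ∈ Z) :
    coverNumber r a q Φ' < coverWeight P := by
  -- `σ` is replaced by its extensions by one further value in `Z`. There are at most |W|² of them,
  -- each with a smaller undefined part, so with base |W|² + 1 they weigh less than `σ` altogether.
  let I : Finset (W × V) := (Finset.univ.filter fun w => σ w = none ∧ w ≠ q) ×ˢ Z
  let R : Finset (W → Option V) := I.image fun p => Function.update σ p.1 (some p.2)
  have hcov : IsCover r a q Φ' (P.erase σ ∪ R) := by
    refine ⟨fun τ hτ => ?_, fun φ hφ => ?_⟩
    · rcases Finset.mem_union.1 hτ with h | h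
      · exact hP.none_at τ (Finset.mem_of_mem_erase h)
      · obtain ⟨p, hp, rfl⟩ := Finset.mem_image.1 h
        simp only [I, Finset.mem_product, Finset.mem_filter, Finset.mem_univ, true_and] at hp
        rw [Function.update_of_ne hp.1.2.symm]
        exact hP.none_at σ hσ
    · obtain ⟨τ, hτ, h1, h2⟩ := hP.cover φ (hsub hφ)
      by_cases hτσ : τ = σ
      · subst hτσ
        obtain ⟨w, hw, hwq, hwZ⟩ := hhit φ hφ h1 h2
        refine ⟨Function.update τ w (some (φ w)), Finset.mem_union_right _
          (Finset.mem_image.2 ⟨(w, φ w), by simp [I, hw, hwq, hwZ], rfl⟩), ?_, ?_⟩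
        · intro w' v hv
          by_cases hww : w' = w
          · subst hww
            simpa using hv
          · rw [Function.update_of_ne hww] at hv
            exact h1 w' v hv
        · intro w' hw'
          by_cases hww : w' = w
          · subst hww
            simp
          · rw [Function.update_of_ne hww]
            exact h2 w' hw'
      · exact ⟨τ, Finset.mem_union_left _ (Finset.mem_erase.2 ⟨hτσ, hτ⟩), h1, h2⟩
  refine hcov.coverNumber_le.trans_lt ?_
  set β := Fintype.card W ^ 2 + 1 with hβ
  obtain ⟨k, hk⟩ : ∃ k, undefCard σ = k + 1 := by
    refine Nat.exists_eq_succ_of_ne_zero (Finset.card_ne_zero_of_mem (a := q) ?_)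
    simpa using hP.none_at σ hσ
  have hR : ∀ τ ∈ R, undefCard τ ≤ k := by
    intro τ hτ
    obtain ⟨p, hp, rfl⟩ := Finset.mem_image.1 hτ
    simp only [I, Finset.mem_product, Finset.mem_filter, Finset.mem_univ, true_and] at hp
    have : (Finset.univ.filter fun w => Function.update σ p.1 (some p.2) w = none) ⊂
        Finset.univ.filter fun w => σ w = none := by
      refine (Finset.ssubset_iff_of_subset fun w hw => ?_).2 ⟨p.1, by simpa using hp.1.1, by simp⟩
      simp only [Finset.mem_filter, Finset.mem_univ, true_and] at hw ⊢
      by_cases hww : w = p.1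
      · subst hww; simp at hw
      · rwa [Function.update_of_ne hww] at hw
    have := Finset.card_lt_card this
    unfold undefCard at hk ⊢
    omega
  have hcardR : R.card ≤ Fintype.card W ^ 2 := by
    refine Finset.card_image_le.trans ?_
    rw [Finset.card_product, sq]
    exact Nat.mul_le_mul (Finset.card_le_univ _) hZ
  calc coverWeight (P.erase σ ∪ R) ≤ coverWeight (P.erase σ) + coverWeight R := by
        unfold coverWeight
        rw [← Finset.sum_union_inter]
        exact Nat.le_add_right _ _
    _ ≤ coverWeight (P.erase σ) + ∑ τ ∈ R, β ^ k :=
        Nat.add_le_add_left (Finset.sum_le_sum fun τ hτ => Nat.pow_le_pow_right (by omega) (hR τ hτ)) _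
    _ ≤ coverWeight (P.erase σ) + Fintype.card W ^ 2 * β ^ k := by
        rw [Finset.sum_const, smul_eq_mul]
        exact Nat.add_le_add_left (Nat.mul_le_mul_right _ hcardR) _
    _ < coverWeight (P.erase σ) + β ^ undefCard σ := by
        rw [hk, pow_succ' β k]
        exact Nat.add_lt_add_left 
          ((Nat.mul_lt_mul_right (Nat.pow_pos (Nat.succ_pos _))).2 (Nat.lt_succ_self _)) _
    _ = coverWeight P := Finset.sum_erase_add _ _ hσ

end Covers

/-! ### Deleting edges until every vertex has many alternatives -/

section Alternatives

variable {V W : Type*} [Fintype W]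

/-- A surviving embedding `φ'` that extends `σ` must meet the image of `φ` outside the domain of
`σ`: otherwise `φ'` can be glued into `φ` along this domain, which makes `φ' q` an alternative for
`φ`, and those are detached. Hence `σ` can be refined. -/
theorem coverNumber_lt_of_detach {H : SimpleGraph W} {G G' : SimpleGraph V} (hle : G' ≤ G)
    {r : V → V → Prop} {low : Set V} {a : Option V} {q : W} {φ : W → V} {P : Finset (W → Option V)}
    (hP : IsCover r a q (embsAt H G r low a q) P) {σ : W → Option V} (hσ : σ ∈ P)
    (hσφ : ∀ w v, σ w = some v → φ w = v) (hσb : ∀ w, φ w ∈ below r a → σ w ≠ none)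
    (hφ : φ ∈ embsAt H G r low a q)
    (halt : ∀ y ∈ alternatives H G r low a q φ, y ∈ low → y ∉ attached G' a)
    (himg : ∀ w, φ w ∈ low → φ w ∉ attached G' a) :
    coverNumber r a q (embsAt H G' r low a q) < coverWeight P := by
  classical
  let Z : Finset V := Finset.univ.image fun w : {w // σ w = none} => φ w
  have hZ : Z.card ≤ Fintype.card W :=
    Finset.card_image_le.trans (Fintype.card_subtype_le _)
  refine coverNumber_lt_of_refine (embsAt_mono hle r low a q) hP hσ Z hZ ?_
  intro φ' hφ' h1 h2
  have hφ'' := embsAt_mono hle r low a q hφ'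
  have hqσ : σ q = none := hP.none_at σ hσ
  by_contra hcon
  push Not at hcon
  -- `φ' q` is low and still attached, unlike the low vertices in the image of `φ`. So the hit
  -- occurs elsewhere than at `q`, which covers must leave undefined.
  have hqZ : φ' q ∉ Z := by
    intro h
    obtain ⟨w', -, h'⟩ := Finset.mem_image.1 h
    exact himg w' (h' ▸ hφ'.2.1) (h' ▸ hφ'.2.2.1)
  have hmiss : ∀ w, σ w = none → φ' w ∉ Z := by
    intro w hw
    by_cases hwq : w = q
    · exact hwq ▸ hqZ
    · exact hcon w hw hwq
  let U : Set W := {w | σ w ≠ none}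
  have hU : ∀ u ∈ U, φ' u = φ u := by
    intro u hu
    obtain ⟨v, hv⟩ := Option.ne_none_iff_exists'.1 hu
    rw [h1 u v hv, hσφ u v hv]
  have hdisj : ∀ w ∉ U, ∀ w' ∉ U, φ' w ≠ φ w' := by
    intro w hw w' hw' h
    refine hmiss w (not_not.1 hw) (Finset.mem_image.2 ⟨⟨w', not_not.1 hw'⟩, Finset.mem_univ _, ?_⟩)
    exact h.symm
  have hg := hφ.1.glue hφ''.1 U hU hdisj q (by simpa [U] using hqσ)
  -- The domain of `σ` contains everything mapped below `a`, so the glued component is no larger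
  -- than the one allowed in `alternatives`.
  have hUb : within H Uᶜ ≤ within H (φ ⁻¹' below r a)ᶜ := by
    refine fun x y hxy => ⟨hxy.1, fun hx => hxy.2.1 (hσb x hx), fun hy => hxy.2.2 (hσb y hy)⟩
  refine halt (φ' q) ⟨_, ⟨hg, ?_⟩, ?_, ?_⟩ hφ'.2.1 hφ'.2.2.1
  · simpa using hφ''.2
  · simp
  · intro x hx
    rw [if_neg fun h => hx (h.mono hUb)]

variable [Fintype V]

/-- The factor by which deleting the attachment of a vertex to the virtual root is more expensive. -/
def attachCost (K : ℕ) : Option V → ℕ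
  | none => K
  | some _ => 1

open Classical in
/-- Detaching the vertices of `X` from `a`. -/
theorem exists_detach (G : SimpleGraph V) (low : Set V) (K : ℕ) (hK : ∀ v ∈ low, G.degree v ≤ K)
    (a : Option V) (X : Finset V) :
    ∃ G' ≤ G, (G.edgeSet \ G'.edgeSet).ncard ≤ X.card * attachCost K a ∧
      ∀ y ∈ X, y ∈ low → y ∉ attached G' a := by
  let D : Finset (Sym2 V) := match a with
    -- Detaching a vertex from the virtual root means isolating it, which for a low vertex costs at
    -- most `K` edges.
    | none => (X.filter (· ∈ low)).biUnion fun x => (G.neighborFinset x).image fun v => s(x, v)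
    | some b => X.image fun x => s(b, x)
  refine ⟨G.deleteEdges D, G.deleteEdges_le _, ?_, ?_⟩
  · have h1 : (G.edgeSet \ (G.deleteEdges (D : Set (Sym2 V))).edgeSet).ncard ≤ D.card := by
      rw [SimpleGraph.edgeSet_deleteEdges, ← Set.ncard_coe_finset]
      refine Set.ncard_le_ncard ?_ (Finset.finite_toSet _)
      intro e he
      by_contra h
      exact he.2 ⟨he.1, h⟩
    refine h1.trans ?_
    cases a with
    | none =>
      refine Finset.card_biUnion_le.trans ?_
      calc _ ≤ ∑ x ∈ X.filter (· ∈ low), K := by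
            refine Finset.sum_le_sum fun x hx => Finset.card_image_le.trans ?_
            rw [SimpleGraph.card_neighborFinset_eq_degree]
            exact hK x (Finset.mem_filter.1 hx).2
        _ ≤ X.card * K := by
            rw [Finset.sum_const, smul_eq_mul]
            exact Nat.mul_le_mul_right _ (Finset.card_le_card (Finset.filter_subset _ _))
    | some b => simpa [attachCost] using (Finset.card_image_le : D.card ≤ _)
  · intro y hyX hylow hy
    cases a with
    | none =>
      obtain ⟨z, hz⟩ := hy
      rw [SimpleGraph.deleteEdges_adj] at hz
      refine hz.2 ?_
      simp only [D, Finset.coe_biUnion, Set.mem_iUnion, Finset.coe_image, Set.mem_image]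
      exact ⟨y, by simp [hyX, hylow], z, by simpa using hz.1, rfl⟩
    | some b =>
      have hy' : (G.deleteEdges (D : Set (Sym2 V))).Adj b y := hy
      rw [SimpleGraph.deleteEdges_adj] at hy'
      exact hy'.2 (by simpa [D] using ⟨y, hyX, Or.inl rfl⟩)

open Classical in
theorem exists_detach_coverNumber_lt {H : SimpleGraph W} {G : SimpleGraph V}
    {r : V → V → Prop} {low : Set V} (K : ℕ) (hK : ∀ v ∈ low, G.degree v ≤ K)
    {a : Option V} {q : W} {φ : W → V} (hφ : φ ∈ embsAt H G r low a q) :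
    ∃ G' ≤ G, (G.edgeSet \ G'.edgeSet).ncard ≤
        ((alternatives H G r low a q φ).ncard + Fintype.card W) * attachCost K a ∧
      coverNumber r a q (embsAt H G' r low a q) < coverNumber r a q (embsAt H G r low a q) := by
  let X : Finset V := (alternatives H G r low a q φ).toFinset ∪ Finset.univ.image φ
  obtain ⟨G', hle, hdel, hX⟩ := exists_detach G low K hK a X
  refine ⟨G', hle, hdel.trans (Nat.mul_le_mul_right _ ?_), ?_⟩
  · refine (Finset.card_union_le _ _).trans (Nat.add_le_add ?_ ?_)
    · rw [← Set.ncard_eq_toFinset_card']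
    · exact Finset.card_image_le
  · obtain ⟨P, hP, hw⟩ := exists_minimal_cover r a q (embsAt H G r low a q) fun φ h => h.2.2.2
    obtain ⟨σ, hσ, h1, h2⟩ := hP.cover φ hφ
    rw [← hw]
    refine coverNumber_lt_of_detach hle hP hσ h1 h2 hφ (fun y hy hl => hX y ?_ hl)
      fun w hl => hX _ ?_ hl
    · exact Finset.mem_union_left _ (by simpa using hy)
    · exact Finset.mem_union_right _ (by simp)

-- While some embedding has too few alternatives, detach them. Each time one cover number falls and
-- none rises, so the cover numbers, weighted by the cost of one detachment, pay for all deletions.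
open Classical in
theorem exists_many_alternatives (H : SimpleGraph W) (r : V → V → Prop) (low : Set V) (K : ℕ)
    (A : Finset (Option V)) (τ : Option V → ℝ) (hτ : ∀ a, 0 ≤ τ a) (G : SimpleGraph V)
    (hK : ∀ v ∈ low, G.degree v ≤ K) :
    ∃ G' ≤ G, ((G.edgeSet \ G'.edgeSet).ncard : ℝ) ≤
        ∑ a ∈ A, ∑ q : W, (τ a + Fintype.card W) * attachCost K a *
          (coverNumber r a q (embsAt H G r low a q)) ∧
      ∀ a ∈ A, ∀ q, ∀ φ ∈ embsAt H G' r low a q,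
        τ a ≤ (alternatives H G' r low a q φ).ncard := by
  let c : Option V × W → ℝ := fun i => (τ i.1 + Fintype.card W) * attachCost K i.1
  have hc : ∀ i, 0 ≤ c i := fun i => by
    have := hτ i.1
    positivity
  let ρ : SimpleGraph V → Option V × W → ℕ := fun G i =>
    coverNumber r i.1 i.2 (embsAt H G r low i.1 i.2)
  suffices h : ∀ N : ℕ, ∀ G : SimpleGraph V, (∀ v ∈ low, G.degree v ≤ K) →
      ∑ i ∈ A ×ˢ Finset.univ, ρ G i = N → ∃ G' ≤ G,
        ((G.edgeSet \ G'.edgeSet).ncard : ℝ) ≤ ∑ i ∈ A ×ˢ Finset.univ, c i * ρ G i ∧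
        ∀ a ∈ A, ∀ q, ∀ φ ∈ embsAt H G' r low a q,
          τ a ≤ (alternatives H G' r low a q φ).ncard by
    obtain ⟨G', hle, h1, h2⟩ := h _ G hK rfl
    exact ⟨G', hle, by rwa [Finset.sum_product] at h1, h2⟩
  intro N
  induction N using Nat.strong_induction_on with
  | _ N ih =>
    intro G hK hN
    by_cases hall : ∀ a ∈ A, ∀ q, ∀ φ ∈ embsAt H G r low a q,
        τ a ≤ (alternatives H G r low a q φ).ncard
    · refine ⟨G, le_rfl, ?_, hall⟩
      simp only [sdiff_self, Set.bot_eq_empty, Set.ncard_empty, Nat.cast_zero]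
      exact Finset.sum_nonneg fun i _ => mul_nonneg (hc i) (Nat.cast_nonneg _)
    · push Not at hall
      obtain ⟨a, ha, q, φ, hφ, hlt⟩ := hall
      obtain ⟨G₂, hle, hdel, hρ⟩ := exists_detach_coverNumber_lt K hK hφ
      have hmem : (a, q) ∈ A ×ˢ (Finset.univ : Finset W) := by simp [ha]
      have hmono : ∀ i, ρ G₂ i ≤ ρ G i := fun i =>
        coverNumber_mono r i.1 i.2 (embsAt_mono hle r low i.1 i.2) fun φ h => h.2.2.2
      have hsum : ∑ i ∈ A ×ˢ (Finset.univ : Finset W), ρ G₂ i < N := by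
        rw [← hN]
        exact Finset.sum_lt_sum (fun i _ => hmono i) ⟨(a, q), hmem, hρ⟩
      obtain ⟨G', hle', hdel', hG'⟩ := ih _ hsum G₂
        (fun v hv => (SimpleGraph.degree_le_of_le hle).trans (hK v hv)) rfl
      refine ⟨G', hle'.trans hle, ?_, hG'⟩
      have hsplit : (G.edgeSet \ G'.edgeSet).ncard ≤
          (G.edgeSet \ G₂.edgeSet).ncard + (G₂.edgeSet \ G'.edgeSet).ncard := by
        refine le_trans (Set.ncard_le_ncard ?_ (Set.toFinite _)) (Set.ncard_union_le _ _)
        intro e he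
        by_cases h : e ∈ G₂.edgeSet
        · exact Or.inr ⟨h, he.2⟩
        · exact Or.inl ⟨he.1, h⟩
      have hdelR : ((G.edgeSet \ G₂.edgeSet).ncard : ℝ) ≤ c (a, q) := by
        calc ((G.edgeSet \ G₂.edgeSet).ncard : ℝ)
            ≤ (((alternatives H G r low a q φ).ncard + Fintype.card W) * attachCost K a : ℕ) := by
              exact_mod_cast hdel
          _ ≤ c (a, q) := by
              push_cast
              exact mul_le_mul_of_nonneg_right (by dsimp only; linarith) (Nat.cast_nonneg _)
      have hcost : c (a, q) ≤ ∑ i ∈ A ×ˢ (Finset.univ : Finset W), (c i * ρ G i - c i * ρ G₂ i) := by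
        refine le_trans ?_ (Finset.single_le_sum (f := fun i => c i * (ρ G i : ℝ) - c i * ρ G₂ i)
          (fun i _ => ?_) hmem)
        · have : (ρ G₂ (a, q) : ℝ) + 1 ≤ ρ G (a, q) := by exact_mod_cast hρ
          have := mul_le_mul_of_nonneg_left this (hc (a, q))
          linarith
        · have : (ρ G₂ i : ℝ) ≤ ρ G i := by exact_mod_cast hmono i
          have := mul_le_mul_of_nonneg_left this (hc i)
          linarith
      rw [Finset.sum_sub_distrib] at hcost
      have : ((G.edgeSet \ G'.edgeSet).ncard : ℝ) ≤
          (G.edgeSet \ G₂.edgeSet).ncard + (G₂.edgeSet \ G'.edgeSet).ncard := by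
        exact_mod_cast hsplit
      linarith

end Alternatives

/-! ### The cleaning lemma -/

section Cleaning

variable {V W : Type*} [Fintype V]

open Classical in
/-- The degree of a vertex; the virtual root is considered to be joined to all vertices. -/
noncomputable def attachSize (G : SimpleGraph V) : Option V → ℕ
  | none => Fintype.card V
  | some v => G.degree v

open Classical in
/-- `G'` is a subgraph of `G` in which the vertices outside `low` are separated, those in `low` have
degree at most `K` in `G`, and any embedding of `H` into `G'` can be rerouted at any vertex outside
`low` (or at the virtual root) in a positive proportion of the possible ways. -/
structure Clean [Fintype W] (H : SimpleGraph W) (G G' : SimpleGraph V) (r : V → V → Prop)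
    (low : Set V) (K : ℕ) (γ : ℝ) : Prop extends Separated G' r low (Fintype.card W) where
  le : G' ≤ G
  tree : IsTreeOrder r
  degree_le : ∀ v ∈ low, G.degree v ≤ K
  alt : ∀ a q, ∀ φ ∈ embsAt H G' r low a q, (∀ v, a = some v → v ∉ low) →
    γ * attachSize G a ≤ (alternatives H G' r low a q φ).ncard

-- The degree intervals are disjoint, so the `I` partial sums add up to at most the total, and the
-- smallest is at most the average.
open Classical in
theorem exists_degree_gap (f : V → ℕ) (κ : ℕ → ℕ) (hκ : Monotone κ) (I : ℕ) (hI : 0 < I) :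
    ∃ i < I, I * ∑ u with κ i < f u ∧ f u ≤ κ (i + 1), f u ≤ ∑ u, f u := by
  have hle : ∑ i ∈ Finset.range I, ∑ u with κ i < f u ∧ f u ≤ κ (i + 1), f u ≤ ∑ u, f u := by
    simp only [Finset.sum_filter]
    rw [Finset.sum_comm]
    refine Finset.sum_le_sum fun u _ => ?_
    rw [← Finset.sum_filter, Finset.sum_const, smul_eq_mul]
    refine (Nat.mul_le_mul_right _ (Finset.card_le_one.2 ?_)).trans (one_mul _).le
    intro i hi j hj
    simp only [Finset.mem_filter] at hi hj
    by_contra hne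
    rcases lt_or_gt_of_ne hne with h | h
    · have := hκ (Nat.succ_le_of_lt h)
      simp only [Nat.succ_eq_add_one] at this
      omega
    · have := hκ (Nat.succ_le_of_lt h)
      simp only [Nat.succ_eq_add_one] at this
      omega
  obtain ⟨i, hi, hmin⟩ := Finset.exists_min_image (Finset.range I)
    (fun i => ∑ u with κ i < f u ∧ f u ≤ κ (i + 1), f u) ⟨0, by simpa using hI⟩
  refine ⟨i, by simpa using hi, le_trans ?_ hle⟩
  have := Finset.card_nsmul_le_sum (Finset.range I) _ _ hmin
  simpa using this

theorem below_ncard_le {r : V → V → Prop} {d : ℕ} (hd : ∀ v, treeLevel r v ≤ d) (a : Option V) :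
    (below r a).ncard ≤ d + 1 := by
  cases a with
  | none => simp [below]
  | some a =>
    have hsub : below r (some a) ⊆ insert a {u | r u a ∧ u ≠ a} := by
      intro u hu
      by_cases h : u = a
      · exact Or.inl h
      · exact Or.inr ⟨hu, h⟩
    refine (Set.ncard_le_ncard hsub (Set.toFinite _)).trans ((Set.ncard_insert_le _ _).trans ?_)
    exact Nat.add_le_add_right (hd a) 1

variable [Fintype W]

-- This serves graphs of bounded size: all vertices count as low, and an embedding is itself the one
-- alternative needed at the virtual root.
open Classical in
theorem clean_univ (H : SimpleGraph W) (G G' : SimpleGraph V) (hle : G' ≤ G) (r : V → V → Prop)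
    (hr : IsTreeOrder r) (K : ℕ) (hK : Fintype.card V ≤ K) (γ : ℝ) (hγ : γ * Fintype.card V ≤ 1) :
    Clean H G G' r Set.univ K γ where
  low_or u v _ := Or.inl trivial
  up a x ha := absurd trivial ha
  chain x y _ _ _ a _ ha := absurd trivial ha
  le := hle
  tree := hr
  degree_le v _ := (SimpleGraph.degree_lt_card_verts _).le.trans hK
  alt a q φ hφ ha := by
    cases a with
    | some v => exact absurd trivial (ha v rfl)
    | none =>
      refine hγ.trans ?_
      have : 0 < (alternatives H G' r Set.univ none q φ).ncard :=
        (Set.ncard_pos (Set.toFinite _)).2 ⟨φ q, φ, hφ, rfl, fun _ _ => rfl⟩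
      exact_mod_cast this

open Classical in
/-- The cost of separating the vertices of high degree and of providing alternatives. -/
theorem exists_clean_of_thresholds (H : SimpleGraph W) (G G₀ : SimpleGraph V) (hle : G₀ ≤ G)
    (r : V → V → Prop) (hr : IsTreeOrder r) (hemb : ∀ u v, G₀.Adj u v → r u v ∨ r v u) (d : ℕ)
    (hd : ∀ v, treeLevel r v ≤ d) (K K' : ℕ) (γ : ℝ) (hγ : 0 ≤ γ) (M : ℕ)
    (hM : M = Fintype.card W *
      ((d + 1 + 1) ^ Fintype.card W * (Fintype.card W ^ 2 + 1) ^ Fintype.card W)) :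
    ∃ G' ≤ G₀, ((G₀.edgeSet \ G'.edgeSet).ncard : ℝ) ≤
        ∑ u with K < G.degree u ∧ G.degree u ≤ K', (G.degree u : ℝ) +
        (Finset.univ.filter fun u => K' < G.degree u).card *
          (d + d * (K + 1) ^ Fintype.card W + M * Fintype.card W : ℕ) +
        M * γ * (K * Fintype.card V + ∑ u, (G.degree u : ℝ)) + M * Fintype.card W * K ∧
      Clean H G G' r {v | G.degree v ≤ K} K γ := by
  obtain ⟨G₁, hle₁, hdel₁, hsep, hgap⟩ :=
    exists_separated G G₀ hle r hr hemb d hd K K' (Fintype.card W)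
  set low : Set V := {v | G.degree v ≤ K} with hlow
  -- Vertices of intermediate degree have lost all their edges, so only the virtual root and the
  -- vertices of degree more than `K'` need alternatives.
  let A : Finset (Option V) := Finset.insertNone (Finset.univ.filter fun u => K' < G.degree u)
  have hK₁ : ∀ v ∈ low, G₁.degree v ≤ K := fun v hv =>
    (SimpleGraph.degree_le_of_le (hle₁.trans hle)).trans hv
  obtain ⟨G₂, hle₂, hdel₂, halt⟩ := exists_many_alternatives H r low K A
    (fun a => γ * attachSize G a) (fun a => by positivity) G₁ hK₁
  refine ⟨G₂, hle₂.trans hle₁, ?_, ⟨hsep.anti hle₂, (hle₂.trans hle₁).trans hle, hr,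
    fun v hv => hv, ?_⟩⟩
  · have hsplit : (G₀.edgeSet \ G₂.edgeSet).ncard ≤
        (G₀.edgeSet \ G₁.edgeSet).ncard + (G₁.edgeSet \ G₂.edgeSet).ncard := by
      refine le_trans (Set.ncard_le_ncard ?_ (Set.toFinite _)) (Set.ncard_union_le _ _)
      intro e he
      by_cases h : e ∈ G₁.edgeSet
      · exact Or.inr ⟨h, he.2⟩
      · exact Or.inl ⟨he.1, h⟩
    have h0 : ((G₀.edgeSet \ G₂.edgeSet).ncard : ℝ) ≤
        (G₀.edgeSet \ G₁.edgeSet).ncard + (G₁.edgeSet \ G₂.edgeSet).ncard := by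
      exact_mod_cast hsplit
    have h1 : ((G₀.edgeSet \ G₁.edgeSet).ncard : ℝ) ≤
        ∑ u with K < G.degree u ∧ G.degree u ≤ K', (G.degree u : ℝ) +
        (Finset.univ.filter fun u => K' < G.degree u).card *
          (d + d * (K + 1) ^ Fintype.card W : ℕ) := by
      exact_mod_cast hdel₁
    have h2 : ((G₁.edgeSet \ G₂.edgeSet).ncard : ℝ) ≤
        ∑ a ∈ A, M * ((γ * attachSize G a + Fintype.card W) * attachCost K a) := by
      refine hdel₂.trans (Finset.sum_le_sum fun a _ => ?_)
      have hx : 0 ≤ (γ * attachSize G a + Fintype.card W) * attachCost K a := by positivity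
      calc _ ≤ ∑ q : W, (γ * attachSize G a + Fintype.card W) * attachCost K a *
            (((d + 1 + 1) ^ Fintype.card W * (Fintype.card W ^ 2 + 1) ^ Fintype.card W : ℕ) : ℝ) := by
              refine Finset.sum_le_sum fun q _ => mul_le_mul_of_nonneg_left ?_ hx
              exact_mod_cast coverNumber_le r a q (embsAt H G₁ r low a q)
                (fun φ h => h.2.2.2) _ (below_ncard_le hd a)
        _ = _ := by
              rw [Finset.sum_const, nsmul_eq_mul, hM, Finset.card_univ]
              push_cast
              ring
    have h3 : ∑ u with K' < G.degree u, (G.degree u : ℝ) ≤ ∑ u, (G.degree u : ℝ) :=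
      Finset.sum_le_sum_of_subset_of_nonneg (Finset.filter_subset _ _) fun _ _ _ => Nat.cast_nonneg _
    have h4 : ∑ a ∈ A, (M : ℝ) * ((γ * attachSize G a + Fintype.card W) * attachCost K a) =
        M * ((γ * Fintype.card V + Fintype.card W) * K) +
        (M * γ * ∑ u with K' < G.degree u, (G.degree u : ℝ) +
          (Finset.univ.filter fun u => K' < G.degree u).card * (M * Fintype.card W)) := by
      simp only [A]
      rw [Finset.sum_insertNone]
      simp only [attachSize, attachCost, Nat.cast_one, mul_one]
      rw [Finset.mul_sum, ← nsmul_eq_mul (Finset.card _), ← Finset.sum_const,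
        ← Finset.sum_add_distrib]
      congr 1
      refine Finset.sum_congr rfl fun u _ => by ring
    have h5 := mul_le_mul_of_nonneg_left h3 (by positivity : 0 ≤ (M : ℝ) * γ)
    push_cast at h1 ⊢
    rw [h4] at h2
    linarith
  · intro a q φ hφ ha
    refine halt a ?_ q φ hφ
    cases a with
    | none => simp [A]
    | some v =>
      have hadj : G₁.Adj v (φ q) := hle₂ hφ.2.2.1
      have := (hgap v _ hadj).resolve_left (ha v rfl)
      simpa [A] using this

end Cleaning

open Classical in
/-- From a graph with few edges one can delete few edges such that the remaining graph is clean. -/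
theorem exists_clean {W : Type*} [Fintype W] (H : SimpleGraph W) (c d : ℕ) {ε : ℝ} (hε : 0 < ε) :
    ∃ (K : ℕ) (γ : ℝ), 0 < γ ∧ ∀ (n : ℕ) (G G₀ : SimpleGraph (Fin n)) (r : Fin n → Fin n → Prop),
      G₀ ≤ G → IsTreeOrder r → (∀ u v, G₀.Adj u v → r u v ∨ r v u) → (∀ v, treeLevel r v ≤ d) →
      ∑ v, G.degree v ≤ c * n →
      ∃ G' ≤ G₀, ((G₀.edgeSet \ G'.edgeSet).ncard : ℝ) ≤ ε * n ∧
        ∃ low, Clean H G G' r low K γ := by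
  set h := Fintype.card W with hh
  obtain ⟨M, hM⟩ : ∃ M, M = h * ((d + 1 + 1) ^ h * (h ^ 2 + 1) ^ h) := ⟨_, rfl⟩
  -- `X K` is the cost per vertex above the next threshold that is not proportional to its degree.
  -- At most `c * n / next K` vertices exceed that threshold, so together they cost at most `ε / 4 *
  -- n`.
  let X : ℕ → ℕ := fun K => d + d * (K + 1) ^ h + M * h
  let next : ℕ → ℕ := fun K => max (K + 1) ⌈c * X K / (ε / 4)⌉₊
  let κ : ℕ → ℕ := fun i => next^[i] 0
  have hκs : ∀ i, κ (i + 1) = next (κ i) := fun i => Function.iterate_succ_apply' _ _ _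
  have hκ : Monotone κ := monotone_nat_of_le_succ fun i => by
    rw [hκs]
    exact (Nat.le_succ _).trans (le_max_left _ _)
  -- Among `I` candidate gaps, the best one carries a degree sum of at most `c * n / I`.
  obtain ⟨I, hI0, hI⟩ : ∃ I : ℕ, 0 < I ∧ (c : ℝ) ≤ ε / 4 * I := by
    refine ⟨⌈c / (ε / 4)⌉₊ + 1, Nat.succ_pos _, ?_⟩
    have := Nat.le_ceil ((c : ℝ) / (ε / 4))
    rw [div_le_iff₀ (by positivity)] at this
    push_cast
    nlinarith
  -- From `n₀` vertices on, the constant cost at the virtual root is affordable; smaller graphs are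
  -- left to `clean_univ`.
  obtain ⟨n₀, hn₀⟩ : ∃ n₀ : ℕ, (M * h * κ I : ℝ) ≤ ε / 4 * n₀ := by
    refine ⟨⌈(M * h * κ I : ℝ) / (ε / 4)⌉₊, ?_⟩
    have := Nat.le_ceil ((M * h * κ I : ℝ) / (ε / 4))
    rw [div_le_iff₀ (by positivity)] at this
    linarith
  obtain ⟨γ, hγ, hγ1, hγ2⟩ : ∃ γ : ℝ, 0 < γ ∧ M * γ * (κ I + c) ≤ ε / 4 ∧ γ * n₀ ≤ 1 := by
    refine ⟨min (ε / 4 / (M * (κ I + c) + 1)) (1 / (n₀ + 1)), by positivity, ?_, ?_⟩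
    · have h1 : min (ε / 4 / (M * (κ I + c) + 1)) (1 / (n₀ + 1 : ℝ)) ≤
          ε / 4 / (M * (κ I + c) + 1) := min_le_left _ _
      rw [le_div_iff₀ (by positivity)] at h1
      have h2 : 0 < min (ε / 4 / (M * (κ I + c) + 1)) (1 / (n₀ + 1 : ℝ)) := by positivity
      nlinarith
    · have h1 : min (ε / 4 / (M * (κ I + c) + 1)) (1 / (n₀ + 1 : ℝ)) ≤ 1 / (n₀ + 1) :=
        min_le_right _ _
      rw [le_div_iff₀ (by positivity)] at h1
      have h2 : 0 < min (ε / 4 / (M * (κ I + c) + 1)) (1 / (n₀ + 1 : ℝ)) := by positivity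
      nlinarith
  refine ⟨max (κ I) n₀, γ, hγ, fun n G G₀ r hle hr hemb hd hdeg => ?_⟩
  by_cases hn : n ≤ n₀
  · refine ⟨G₀, le_rfl, by simp; positivity, Set.univ, clean_univ H G G₀ hle r hr _ ?_ γ ?_⟩
    · simpa using Or.inr hn
    · have : (n : ℝ) ≤ n₀ := by exact_mod_cast hn
      rw [Fintype.card_fin]
      nlinarith
  · push Not at hn
    obtain ⟨i, hiI, hi⟩ := exists_degree_gap (fun v => G.degree v) κ hκ I hI0
    obtain ⟨G', hle', hdel, hclean⟩ := exists_clean_of_thresholds H G G₀ hle r hr hemb d hd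
      (κ i) (κ (i + 1)) γ hγ.le M hM
    have hiI' : κ i ≤ κ I := hκ hiI.le
    refine ⟨G', hle', hdel.trans ?_, _, { hclean with
      degree_le := fun v hv => (hclean.degree_le v hv).trans (hiI'.trans (le_max_left _ _)) }⟩
    rw [Fintype.card_fin, ← hh]
    have hdegR : ∑ v, (G.degree v : ℝ) ≤ c * n := by exact_mod_cast hdeg
    have hnR : (n₀ : ℝ) ≤ n := by exact_mod_cast hn.le
    have hiR : (κ i : ℝ) ≤ κ I := by exact_mod_cast hiI'
    have hIpos : (0 : ℝ) < I := by exact_mod_cast hI0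
    have t1 : ∑ u with κ i < G.degree u ∧ G.degree u ≤ κ (i + 1), (G.degree u : ℝ) ≤
        ε / 4 * n := by
      have h1 : (I : ℝ) * ∑ u with κ i < G.degree u ∧ G.degree u ≤ κ (i + 1), (G.degree u : ℝ) ≤
          ∑ v, (G.degree v : ℝ) := by exact_mod_cast hi
      have h2 : (c : ℝ) * n ≤ ε / 4 * I * n := mul_le_mul_of_nonneg_right hI (Nat.cast_nonneg _)
      refine le_of_mul_le_mul_left ?_ hIpos
      linarith
    have t2 : ((Finset.univ.filter fun u => κ (i + 1) < G.degree u).card : ℝ) * (X (κ i) : ℕ) ≤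
        ε / 4 * n := by
      have hK' : (c * X (κ i) : ℝ) ≤ ε / 4 * κ (i + 1) := by
        have h1 : c * X (κ i) / (ε / 4) ≤ (κ (i + 1) : ℝ) := by
          rw [hκs]
          refine (Nat.le_ceil _).trans ?_
          exact Nat.cast_le.2 (le_max_right (κ i + 1) ⌈c * X (κ i) / (ε / 4)⌉₊)
        rw [div_le_iff₀ (by positivity)] at h1
        linarith
      have hpos : (0 : ℝ) < κ (i + 1) := by
        rw [hκs]
        exact_mod_cast (Nat.succ_pos _).trans_le (le_max_left _ _)
      have hcard : ((Finset.univ.filter fun u => κ (i + 1) < G.degree u).card : ℝ) * κ (i + 1) ≤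
          c * n := by
        refine le_trans ?_ hdegR
        calc _ = ∑ u with κ (i + 1) < G.degree u, (κ (i + 1) : ℝ) := by
              rw [Finset.sum_const, nsmul_eq_mul]
          _ ≤ ∑ u with κ (i + 1) < G.degree u, (G.degree u : ℝ) :=
              Finset.sum_le_sum fun u hu => by exact_mod_cast (Finset.mem_filter.1 hu).2.le
          _ ≤ _ := Finset.sum_le_sum_of_subset_of_nonneg (Finset.filter_subset _ _)
              fun _ _ _ => Nat.cast_nonneg _
      refine le_of_mul_le_mul_right ?_ hpos
      calc _ = ((Finset.univ.filter fun u => κ (i + 1) < G.degree u).card : ℝ) * κ (i + 1) *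
            X (κ i) := by ring
        _ ≤ c * n * X (κ i) := mul_le_mul_of_nonneg_right hcard (Nat.cast_nonneg _)
        _ = (c * X (κ i)) * n := by ring
        _ ≤ ε / 4 * κ (i + 1) * n := mul_le_mul_of_nonneg_right hK' (Nat.cast_nonneg _)
        _ = _ := by ring
    have t3 : M * γ * (κ i * n + ∑ u, (G.degree u : ℝ)) ≤ ε / 4 * n := by
      calc _ ≤ M * γ * (κ I * n + c * n) := by gcongr
        _ = M * γ * (κ I + c) * n := by ring
        _ ≤ _ := mul_le_mul_of_nonneg_right hγ1 (Nat.cast_nonneg _)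
    have t4 : (M * h * κ i : ℝ) ≤ ε / 4 * n := by
      calc _ ≤ (M * h * κ I : ℝ) := by gcongr
        _ ≤ ε / 4 * n₀ := hn₀
        _ ≤ _ := by gcongr
    have t2' : ((Finset.univ.filter fun u => κ (i + 1) < G.degree u).card : ℝ) *
        ((d + d * (κ i + 1) ^ h + M * h : ℕ) : ℝ) ≤ ε / 4 * n := t2
    linarith

/-! ### Explorations -/

section Exploration

variable {V W : Type*}

theorem reachable_induction {G : SimpleGraph V} {x y : V} (h : G.Reachable x y) {P : V → Prop}
    (hx : P x) (hstep : ∀ u v, P u → G.Adj u v → P v) : P y := by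
  obtain ⟨w⟩ := h
  induction w with
  | nil => exact hx
  | cons h _ ih => exact ih (hstep _ _ hx h)

theorem within_mono {G : SimpleGraph V} {S T : Set V} (h : S ⊆ T) : within G S ≤ within G T :=
  fun _ _ hxy => ⟨hxy.1, h hxy.2.1, h hxy.2.2⟩

/-- A partially discovered embedding `φ` of `H`: the edges in `E` have been found, as edges of `F`.
The set `D` is the closure of the set of the discovered vertices under taking neighbors of vertices
in `low`, and the neighborhoods of the components of the rest of `H` are chains. -/
structure Exploration (H : SimpleGraph W) (G : SimpleGraph V) (r : V → V → Prop) (low : Set V)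
    (F : SimpleGraph V) (φ : W → V) (D : Set W) (E : Set (Sym2 W)) : Prop where
  emb : IsEmb H G φ
  sub : E ⊆ H.edgeSet
  found : ∀ p q, s(p, q) ∈ E → F.Adj (φ p) (φ q)
  ends : ∀ p q, s(p, q) ∈ E → p ∈ D
  closed : ∀ p ∈ D, φ p ∈ low → ∀ q, H.Adj p q → q ∈ D
  chain : ∀ x y p₁ p₂, x ∉ D → (within H Dᶜ).Reachable x y → p₁ ∈ D → p₂ ∈ D →
    H.Adj p₁ x → H.Adj p₂ y → r (φ p₁) (φ p₂) ∨ r (φ p₂) (φ p₁)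
  conn : ∀ p ∈ D, φ p ∈ low → ∃ t u, φ t ∈ low ∧ t ∈ D ∧ s(t, u) ∈ E ∧
    (within H {x | x ∈ D ∧ φ x ∈ low}).Reachable t p
  high : ∀ p ∈ D, φ p ∉ low → ∃ t ∈ D, φ t ∈ low ∧ H.Adj p t

variable {H : SimpleGraph W} {G : SimpleGraph V} {r : V → V → Prop} {low : Set V}
  {F F' : SimpleGraph V} {φ φ' : W → V} {D : Set W} {E : Set (Sym2 W)}

/-- By `closed`, the other end `u` already belongs to `D`, so only the set of found edges grows. -/
theorem Exploration.insert_edge (ex : Exploration H G r low F φ D E) (hF : F ≤ F') {t u : W}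
    (ht : t ∈ D) (htl : φ t ∈ low) (htu : H.Adj t u) (hfound : F'.Adj (φ t) (φ u)) :
    Exploration H G r low F' φ D (insert s(t, u) E) where
  emb := ex.emb
  sub := Set.insert_subset htu ex.sub
  found p q hpq := by
    rcases hpq with h | h
    · rcases Sym2.eq_iff.1 h with ⟨rfl, rfl⟩ | ⟨rfl, rfl⟩
      · exact hfound
      · exact hfound.symm
    · exact hF (ex.found p q h)
  ends p q hpq := by
    rcases hpq with h | h
    · rcases Sym2.eq_iff.1 h with ⟨rfl, rfl⟩ | ⟨rfl, rfl⟩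
      · exact ht
      · exact ex.closed _ ht htl _ htu
    · exact ex.ends p q h
  closed := ex.closed
  chain := ex.chain
  conn p hp hpl := by
    obtain ⟨t, u, h1, h2, h3, h4⟩ := ex.conn p hp hpl
    exact ⟨t, u, h1, h2, Or.inr h3, h4⟩
  high := ex.high

theorem reachable_within_of_adj {S : Set W} {q x y : W} (hq : q ∈ S)
    (h : (within H S).Reachable q x) (hxy : H.Adj x y) (hy : y ∈ S) :
    (within H S).Reachable q y :=
  h.trans (SimpleGraph.Adj.reachable ⟨hxy, mem_of_reachable_within h hq, hy⟩)

/-- A path in `H` has fewer than |W| edges, and so has its image. This is why separation is only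
needed for walks of length at most |W|. -/
theorem Separated.chain_of_reachable [Fintype W] (hsep : Separated G r low (Fintype.card W))
    (hφ : IsEmb H G φ) {x y a b : W} (hx : φ x ∈ low)
    (hxy : (within H (φ ⁻¹' low)).Reachable x y) (ha : φ a ∉ low) (hb : φ b ∉ low)
    (hax : H.Adj a x) (hby : H.Adj b y) : r (φ a) (φ b) ∨ r (φ b) (φ a) := by
  classical
  obtain ⟨w, hw⟩ := hxy.exists_isPath
  let f : within H (φ ⁻¹' low) →g within G low :=
    ⟨φ, fun {u v} h => ⟨hφ.adj u v h.1, h.2.1, h.2.2⟩⟩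
  refine hsep.chain (φ x) (φ y) hx (w.map f) ?_ _ _ ha hb (hφ.adj _ _ hax) (hφ.adj _ _ hby)
  rw [SimpleGraph.Walk.length_map]
  exact hw.length_lt.le

/-- All vertices of `D` attached to the component of `q` outside `D` are mapped below `a`, so `φ'`
differs from `φ` only on this component. Newly discovered are `L`, the part of `H` around `q` that
`φ'` maps to low vertices, and its neighbors. What remains of the component is attached to vertices
below `a` and to high neighbors of `L`. The latter form a chain by separation; if `a` is a vertex it
is one of them, hence the former are comparable with them. -/
theorem Exploration.reroute [Fintype W] (hr : IsTreeOrder r)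
    (hsep : Separated G r low (Fintype.card W)) (ex : Exploration H G r low F φ D E) (hF : F ≤ F')
    {q : W} (hq : q ∉ D) {a : Option V}
    (hbelow : ∀ p ∈ D, ∀ x, (within H Dᶜ).Reachable q x → H.Adj p x → φ p ∈ below r a)
    (ha : ∀ c, a = some c → ∃ p ∈ D, φ p = c ∧ φ p ∉ low ∧ H.Adj p q)
    (hφ' : IsEmb H G φ') (hlow : φ' q ∈ low)
    (hoff : ∀ x, ¬ (within H (φ ⁻¹' below r a)ᶜ).Reachable q x → φ' x = φ x)
    {s : W} (hqs : H.Adj q s) (hfound : F'.Adj (φ' q) (φ' s)) :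
    ∃ D', Exploration H G r low F' φ' D' (insert s(q, s) E) := by
  have hQ : ∀ x, (within H Dᶜ).Reachable q x → x ∉ D := fun x hx => mem_of_reachable_within hx hq
  have hstep : ∀ x y, (within H Dᶜ).Reachable q x → H.Adj x y → y ∉ D →
      (within H Dᶜ).Reachable q y := fun x y hx hxy hy => reachable_within_of_adj hq hx hxy hy
  have hoffQ : ∀ x, ¬ (within H Dᶜ).Reachable q x → φ' x = φ x := by
    intro x hx
    refine hoff x fun h => hx ?_
    refine reachable_induction h (P := fun x => (within H Dᶜ).Reachable q x)
      (SimpleGraph.Reachable.refl _) fun u v hu huv => ?_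
    exact hstep u v hu huv.1 fun hv => huv.2.2 (hbelow v hv u hu huv.1.symm)
  have hD : ∀ x ∈ D, φ' x = φ x := fun x hx => hoffQ x fun h => hQ x h hx
  let L : Set W := {x | (within H (φ' ⁻¹' low)).Reachable q x}
  have hLlow : ∀ x ∈ L, φ' x ∈ low := fun x hx =>
    mem_of_reachable_within (S := φ' ⁻¹' low) hx hlow
  have hLadj : ∀ x ∈ L, ∀ y, H.Adj x y → φ' y ∈ low → y ∈ L := fun x hx y hxy hy =>
    reachable_within_of_adj (S := φ' ⁻¹' low) hlow hx hxy hy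
  have hqL : q ∈ L := SimpleGraph.Reachable.refl _
  have hLQ : ∀ x ∈ L, (within H Dᶜ).Reachable q x := by
    intro x hx
    refine reachable_induction hx (P := fun x => (within H Dᶜ).Reachable q x)
      (SimpleGraph.Reachable.refl _) fun u v hu huv => ?_
    refine hstep u v hu huv.1 fun hv => hQ u hu (ex.closed v hv ?_ u huv.1.symm)
    rw [← hD v hv]
    exact huv.2.2
  let D' : Set W := {x | x ∈ D ∨ x ∈ L ∨ ∃ y ∈ L, H.Adj y x}
  have hDD' : D ⊆ D' := fun x hx => Or.inl hx
  have hLD' : L ⊆ D' := fun x hx => Or.inr (Or.inl hx)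
  have hclosed : ∀ p ∈ D', φ' p ∈ low → ∀ u, H.Adj p u → u ∈ D' := by
    rintro p (hp | hp | ⟨y, hy, hyp⟩) hpl u hpu
    · exact Or.inl (ex.closed p hp (hD p hp ▸ hpl) u hpu)
    · exact Or.inr (Or.inr ⟨p, hp, hpu⟩)
    · exact Or.inr (Or.inr ⟨p, hLadj y hy p hyp hpl, hpu⟩)
  refine ⟨D', ⟨hφ', Set.insert_subset hqs ex.sub, ?_, ?_, hclosed, ?_, ?_, ?_⟩⟩
  · intro p u hpu
    rcases hpu with h | h
    · rcases Sym2.eq_iff.1 h with ⟨rfl, rfl⟩ | ⟨rfl, rfl⟩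
      · exact hfound
      · exact hfound.symm
    · rw [hD p (ex.ends p u h), hD u (ex.ends u p (Sym2.eq_swap ▸ h))]
      exact hF (ex.found p u h)
  · intro p u hpu
    rcases hpu with h | h
    · rcases Sym2.eq_iff.1 h with ⟨rfl, rfl⟩ | ⟨rfl, rfl⟩
      · exact hLD' hqL
      · exact Or.inr (Or.inr ⟨_, hqL, hqs⟩)
    · exact hDD' (ex.ends p u h)
  · intro x y p₁ p₂ hx hxy hp₁ hp₂ h₁ h₂
    have hy : y ∉ D' := mem_of_reachable_within (S := D'ᶜ) hxy hx
    have hxy' : (within H Dᶜ).Reachable x y := hxy.mono (within_mono (Set.compl_subset_compl.2 hDD'))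
    have hhigh₁ : φ' p₁ ∉ low := fun h => hx (hclosed p₁ hp₁ h x h₁)
    have hhigh₂ : φ' p₂ ∉ low := fun h => hy (hclosed p₂ hp₂ h y h₂)
    by_cases hxQ : (within H Dᶜ).Reachable q x
    · have hyQ := hxQ.trans hxy'
      have hcase : ∀ p z, p ∈ D' → φ' p ∉ low → H.Adj p z → (within H Dᶜ).Reachable q z →
          (∃ c, a = some c ∧ r (φ' p) c) ∨ ∃ u ∈ L, H.Adj p u := by
        rintro p z (hp | hp | ⟨u, hu, hup⟩) hph hpz hz
        · left
          have := hbelow p hp z hz hpz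
          rw [← hD p hp] at this
          cases a with
          | none => exact absurd this (Set.notMem_empty _)
          | some c => exact ⟨c, rfl, this⟩
        · exact absurd (hLlow p hp) hph
        · exact Or.inr ⟨u, hu, hup.symm⟩
      have hmixed : ∀ p p' c u, a = some c → r (φ' p) c → φ' p' ∉ low → u ∈ L → H.Adj p' u →
          r (φ' p) (φ' p') ∨ r (φ' p') (φ' p) := by
        intro p p' c u hac hpc hp' hu hpu
        obtain ⟨b, hb, hbc, hbl, hbq⟩ := ha c hac
        rw [← hD b hb] at hbc hbl
        rcases hsep.chain_of_reachable hφ' hlow hu hbl hp' hbq hpu with h | h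
        · exact Or.inl (hr.trans _ _ _ hpc (hbc ▸ h))
        · exact hr.total_below _ _ _ hpc (hbc ▸ h)
      rcases hcase p₁ x hp₁ hhigh₁ h₁ hxQ with ⟨c, hac, hc⟩ | ⟨u, hu, hpu⟩
      · rcases hcase p₂ y hp₂ hhigh₂ h₂ hyQ with ⟨c', hac', hc'⟩ | ⟨u', hu', hpu'⟩
        · obtain rfl : c = c' := Option.some.inj (hac.symm.trans hac')
          exact hr.total_below _ _ _ hc hc'
        · exact hmixed p₁ p₂ c u' hac hc hhigh₂ hu' hpu'
      · rcases hcase p₂ y hp₂ hhigh₂ h₂ hyQ with ⟨c', hac', hc'⟩ | ⟨u', hu', hpu'⟩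
        · exact (hmixed p₂ p₁ c' u hac' hc' hhigh₁ hu hpu).symm
        · exact hsep.chain_of_reachable hφ' (hLlow u hu) (SimpleGraph.Reachable.trans hu.symm hu')
            hhigh₁ hhigh₂ hpu hpu'
    -- Elsewhere nothing changes: the neighbors in `D'` of another component already belong to `D`.
    · have hxD : x ∉ D := fun h => hx (hDD' h)
      have hyD : y ∉ D := fun h => hy (hDD' h)
      have hcase : ∀ p z, p ∈ D' → H.Adj p z → z ∉ D → ¬ (within H Dᶜ).Reachable q z → p ∈ D := by
        intro p z hp hpz hz hzQ
        by_contra hpD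
        have hpQ : (within H Dᶜ).Reachable q p := by
          rcases hp with hp | hp | ⟨u, hu, hup⟩
          · exact absurd hp hpD
          · exact hLQ p hp
          · exact hstep u p (hLQ u hu) hup hpD
        exact hzQ (hstep p z hpQ hpz hz)
      have hp₁D := hcase p₁ x hp₁ h₁ hxD hxQ
      have hp₂D := hcase p₂ y hp₂ h₂ hyD fun h => hxQ (h.trans hxy'.symm)
      rw [hD p₁ hp₁D, hD p₂ hp₂D]
      exact ex.chain x y p₁ p₂ hxD hxy' hp₁D hp₂D h₁ h₂
  · intro p hp hpl
    by_cases hpD : p ∈ D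
    · obtain ⟨t, u, h1, h2, h3, h4⟩ := ex.conn p hpD (hD p hpD ▸ hpl)
      refine ⟨t, u, hD t h2 ▸ h1, hDD' h2, Or.inr h3, h4.mono (within_mono fun x hx => ?_)⟩
      refine ⟨hDD' hx.1, ?_⟩
      rw [hD x hx.1]
      exact hx.2
    · have hpL : p ∈ L := by
        rcases hp with hp | hp | ⟨u, hu, hup⟩
        · exact absurd hp hpD
        · exact hp
        · exact hLadj u hu p hup hpl
      refine ⟨q, s, hlow, hLD' hqL, Or.inl rfl, ?_⟩
      refine (reachable_induction hpL (P := fun x => x ∈ L ∧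
        (within H {x | x ∈ D' ∧ φ' x ∈ low}).Reachable q x)
        ⟨hqL, SimpleGraph.Reachable.refl _⟩ fun u v hu huv => ?_).2
      have hv := hLadj u hu.1 v huv.1 huv.2.2
      exact ⟨hv, hu.2.trans (SimpleGraph.Adj.reachable
        ⟨huv.1, ⟨hLD' hu.1, hLlow u hu.1⟩, hLD' hv, hLlow v hv⟩)⟩
  · rintro p (hp | hp | ⟨u, hu, hup⟩) hpl
    · obtain ⟨t, h1, h2, h3⟩ := ex.high p hp (hD p hp ▸ hpl)
      exact ⟨t, hDD' h1, hD t h1 ▸ h2, h3⟩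
    · exact absurd (hLlow p hp) hpl
    · exact ⟨u, hLD' hu, hLlow u hu, hup.symm⟩

/-- All edges at the discovered vertices in `low` are found, if this holds for those of these
vertices that are ends of found edges. -/
theorem Exploration.saturated (ex : Exploration H G r low F φ D E)
    (hsat : ∀ t u v, s(t, u) ∈ E → φ t ∈ low → H.Adj t v → s(t, v) ∈ E) :
    ∀ p ∈ D, φ p ∈ low → ∀ u, H.Adj p u → s(p, u) ∈ E := by
  intro p hp hpl
  obtain ⟨t, u, h1, h2, h3, h4⟩ := ex.conn p hp hpl
  refine reachable_induction h4 (P := fun x => ∀ u, H.Adj x u → s(x, u) ∈ E)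
    (fun v hv => hsat t u v h3 h1 hv) fun x y hx hxy v hv => ?_
  exact hsat y x v (Sym2.eq_swap ▸ hx y hxy.1) hxy.2.2.2 hv

/-! ### Progress of an exploration -/

/-- At most `m` edges remain to be found. -/
def Explorable (H : SimpleGraph W) (G : SimpleGraph V) (r : V → V → Prop) (low : Set V) (m : ℕ)
    (F : SimpleGraph V) : Prop :=
  ∃ φ D E, Exploration H G r low F φ D E ∧ H.edgeSet.ncard ≤ E.ncard + m

theorem Explorable.mono {m m' : ℕ} (h : Explorable H G r low m F) (hm : m ≤ m') (hF : F ≤ F') :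
    Explorable H G r low m' F' := by
  obtain ⟨φ, D, E, ex, hE⟩ := h
  exact ⟨φ, D, E, { ex with found := fun p q h => hF (ex.found p q h) }, by omega⟩

theorem IsEmb.explorable (hφ : IsEmb H G φ) : Explorable H G r low H.edgeSet.ncard F :=
  ⟨φ, ∅, ∅, ⟨hφ, Set.empty_subset _, fun _ _ h => absurd h (Set.notMem_empty _),
    fun _ _ h => absurd h (Set.notMem_empty _), fun _ h => absurd h (Set.notMem_empty _),
    fun _ _ _ _ _ _ h => absurd h (Set.notMem_empty _), fun _ h => absurd h (Set.notMem_empty _),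
    fun _ h => absurd h (Set.notMem_empty _)⟩, by simp⟩

theorem Explorable.exists_isEmb [Finite W] (h : Explorable H G r low 0 F) : ∃ φ, IsEmb H F φ := by
  obtain ⟨φ, D, E, ex, hE⟩ := h
  have : E = H.edgeSet := Set.eq_of_subset_of_ncard_le ex.sub (by simpa using hE) (Set.toFinite _)
  exact ⟨φ, ex.emb.inj, fun p q hpq => ex.found p q (this ▸ hpq)⟩

open Classical in
/-- As long as edges remain to be found, a random neighbor of a discovered vertex, or a random
neighbor of a random vertex, reveals one with positive probability. -/
theorem Explorable.progress [Fintype V] [Fintype W] {G₀ : SimpleGraph V} {K : ℕ} {γ δ : ℝ}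
    (hc : Clean H G₀ G r low K γ) (hδγ : δ ≤ γ) (hδK : δ * K ≤ 1) (hδ : 0 ≤ δ) {m : ℕ}
    (h : Explorable H G r low (m + 1) F) :
    Explorable H G r low m F ∨
    (∃ v u, F.Adj v u ∧ ∃ Y : Finset V, Y ⊆ G₀.neighborFinset v ∧ Y.Nonempty ∧
      δ * G₀.degree v ≤ Y.card ∧
      ∀ y ∈ Y, ∀ F', F ≤ F' → F'.Adj v y → Explorable H G r low m F') ∨
    (∃ Y : Finset V, Y.Nonempty ∧ δ * Fintype.card V ≤ Y.card ∧
      ∀ y ∈ Y, G₀.degree y ≤ K ∧ ∃ z, G₀.Adj y z ∧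
        ∀ F', F ≤ F' → F'.Adj y z → Explorable H G r low m F') := by
  obtain ⟨φ, D, E, ex, hE⟩ := h
  have hins : ∀ e, e ∉ E → H.edgeSet.ncard ≤ (insert e E).ncard + m := by
    intro e he
    rw [Set.ncard_insert_of_notMem he (Set.toFinite _)]
    omega
  by_cases hlt : H.edgeSet.ncard ≤ E.ncard + m
  · exact Or.inl ⟨φ, D, E, ex, hlt⟩
  refine Or.inr ?_
  by_cases hsat : ∀ t u v, s(t, u) ∈ E → φ t ∈ low → H.Adj t v → s(t, v) ∈ E
  swap
  -- An edge is missing at a low vertex that has been seen. Its degree is at most `K`, so the single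
  -- right answer is a sufficient proportion.
  · push Not at hsat
    obtain ⟨t, u, v, htu, htl, htv, hnot⟩ := hsat
    refine Or.inl ⟨φ t, φ u, ex.found t u htu, {φ v}, ?_, Finset.singleton_nonempty _, ?_, ?_⟩
    · simpa using hc.le (ex.emb.adj t v htv)
    · have : (G₀.degree (φ t) : ℝ) ≤ K := by exact_mod_cast hc.degree_le _ htl
      rw [Finset.card_singleton]
      push_cast
      exact (mul_le_mul_of_nonneg_left this hδ).trans hδK
    · intro y hy F' hF hF'
      rw [Finset.mem_singleton.1 hy] at hF'
      exact ⟨φ, D, _, ex.insert_edge hF (ex.ends t u htu) htl htv hF', hins _ hnot⟩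
  have hall := ex.saturated hsat
  have hEout : ∀ q s, q ∉ D → s(q, s) ∉ E := fun q s hq h => hq (ex.ends q s h)
  obtain ⟨e, he, heE⟩ := Set.exists_mem_notMem_of_ncard_lt_ncard
    (s := E) (t := H.edgeSet) (by omega) (Set.toFinite _)
  obtain ⟨x, s, hxs, hxl, hxE⟩ : ∃ x s, H.Adj x s ∧ φ x ∈ low ∧ s(x, s) ∉ E := by
    induction e with
    | _ u v =>
      rcases hc.low_or _ _ (ex.emb.adj u v he) with h | h
      · exact ⟨u, v, he, h, heE⟩
      · exact ⟨v, u, he.symm, h, fun h' => heE (Sym2.eq_swap ▸ h')⟩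
  have hxD : x ∉ D := fun h => hxE (hall x h hxl s hxs)
  let N : Finset W := Finset.univ.filter fun p => p ∈ D ∧
    ∃ z, (within H Dᶜ).Reachable x z ∧ H.Adj p z
  by_cases hN : N.Nonempty
  · left
    -- The attachments of the component of `x` are mapped to a chain. The topmost one is chosen
    -- because rerouting needs all others below it.
    obtain ⟨p, hpN, hmax⟩ : ∃ p ∈ N, ∀ p' ∈ N, r (φ p') (φ p) := by
      have hchain : ∀ p ∈ N, ∀ p' ∈ N, r (φ p) (φ p') ∨ r (φ p') (φ p) := by
        intro p hp p' hp'
        obtain ⟨hpD, z, hz, hpz⟩ := (Finset.mem_filter.1 hp).2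
        obtain ⟨hpD', z', hz', hpz'⟩ := (Finset.mem_filter.1 hp').2
        exact ex.chain z z' p p' (mem_of_reachable_within (S := Dᶜ) hz hxD) (hz.symm.trans hz')
          hpD hpD' hpz hpz'
      have hsub : ∀ N' : Finset W, N' ⊆ N → N'.Nonempty → ∃ p ∈ N', ∀ p' ∈ N', r (φ p') (φ p) := by
        intro N' hN' hne
        induction hne using Finset.Nonempty.cons_induction with
        | singleton a => exact ⟨a, by simp, by simp [hc.tree.refl]⟩
        | cons a t hat hne ih =>
          obtain ⟨p, hp, hpm⟩ := ih fun x hx => hN' (Finset.mem_cons_of_mem hx)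
          rcases hchain a (hN' (Finset.mem_cons_self _ _)) p (hN' (Finset.mem_cons_of_mem hp))
            with h | h
          · refine ⟨p, Finset.mem_cons_of_mem hp, fun p' hp' => ?_⟩
            rcases Finset.mem_cons.1 hp' with rfl | hp'
            · exact h
            · exact hpm p' hp'
          · refine ⟨a, Finset.mem_cons_self _ _, fun p' hp' => ?_⟩
            rcases Finset.mem_cons.1 hp' with rfl | hp'
            · exact hc.tree.refl _
            · exact hc.tree.trans _ _ _ (hpm p' hp') h
      exact hsub N (Finset.Subset.refl _) hN
    obtain ⟨hpD, q, hxq, hpq⟩ := (Finset.mem_filter.1 hpN).2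
    have hqD : q ∉ D := mem_of_reachable_within (S := Dᶜ) hxq hxD
    -- `p` is high because `D` is closed, and so `q` is low. By saturation the edge from `p` to its
    -- low neighbor `t` in `D` has been found, so `φ p` is available for a query.
    have hph : φ p ∉ low := fun h => hqD (ex.closed p hpD h q hpq)
    have hql : φ q ∈ low := (hc.low_or _ _ (ex.emb.adj p q hpq)).resolve_left hph
    obtain ⟨t, htD, htl, hpt⟩ := ex.high p hpD hph
    have hmem : φ ∈ embsAt H G r low (some (φ p)) q :=
      ⟨ex.emb, hql, ex.emb.adj p q hpq, hc.up _ _ hph (ex.emb.adj p q hpq)⟩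
    have hpfix : ∀ φ' : W → V, (∀ x, ¬ (within H (φ ⁻¹' below r (some (φ p)))ᶜ).Reachable q x →
        φ' x = φ x) → φ' p = φ p := by
      intro φ' hoff
      refine hoff p fun h => ?_
      exact mem_of_reachable_within (S := (φ ⁻¹' below r (some (φ p)))ᶜ) h (hmem.2.2.2)
        (hc.tree.refl _)
    refine ⟨φ p, φ t, (ex.found t p (hall t htD htl p hpt.symm)).symm,
      (alternatives H G r low (some (φ p)) q φ).toFinset, ?_, ?_, ?_, ?_⟩
    · intro y hy
      obtain ⟨φ', hφ', rfl, hoff⟩ := Set.mem_toFinset.1 hy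
      simpa using hc.le hφ'.2.2.1
    · exact ⟨φ q, Set.mem_toFinset.2 ⟨φ, hmem, rfl, fun _ _ => rfl⟩⟩
    · rw [← Set.ncard_eq_toFinset_card']
      refine le_trans (mul_le_mul_of_nonneg_right hδγ (Nat.cast_nonneg _))
        (hc.alt (some (φ p)) q φ hmem ?_)
      rintro v ⟨⟩
      exact hph
    · intro y hy F' hF hF'
      obtain ⟨φ', hφ', rfl, hoff⟩ := Set.mem_toFinset.1 hy
      obtain ⟨D', ex'⟩ := ex.reroute (a := some (φ p)) hc.tree hc.toSeparated hF hqD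
        (fun p' hp' z hz hpz => hmax p' (Finset.mem_filter.2 ⟨Finset.mem_univ _, hp', z,
          hxq.trans hz, hpz⟩))
        (fun c hcp => ⟨p, hpD, Option.some.inj hcp, hph, hpq⟩) hφ'.1 hφ'.2.1 hoff hpq.symm
        (hpfix φ' hoff ▸ hF'.symm)
      exact ⟨φ', D', _, ex', hins _ (hEout q p hqD)⟩
  · right
    -- Nothing discovered is attached to this component, so the virtual root applies: a random
    -- vertex is an alternative for `φ x` with positive probability.
    have hmem : φ ∈ embsAt H G r low none x :=
      ⟨ex.emb, hxl, ⟨_, ex.emb.adj x s hxs⟩, Set.notMem_empty _⟩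
    refine ⟨(alternatives H G r low none x φ).toFinset, ?_, ?_, ?_⟩
    · exact ⟨φ x, Set.mem_toFinset.2 ⟨φ, hmem, rfl, fun _ _ => rfl⟩⟩
    · rw [← Set.ncard_eq_toFinset_card']
      exact le_trans (mul_le_mul_of_nonneg_right hδγ (Nat.cast_nonneg _))
        (hc.alt none x φ hmem (by simp))
    · intro y hy
      obtain ⟨φ', hφ', rfl, hoff⟩ := Set.mem_toFinset.1 hy
      refine ⟨hc.degree_le _ hφ'.2.1, φ' s, hc.le (hφ'.1.adj x s hxs), fun F' hF hF' => ?_⟩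
      obtain ⟨D', ex'⟩ := ex.reroute (a := none) hc.tree hc.toSeparated hF hxD
        (fun p hp z hz hpz => absurd ⟨p, Finset.mem_filter.2 ⟨Finset.mem_univ _, hp, z, hz, hpz⟩⟩ hN)
        (by simp) hφ'.1 hφ'.2.1 hoff hxs hF'
      exact ⟨φ', D', _, ex', hins _ (hEout x s hxD)⟩

end Exploration

/-! ### Graphs of bounded expansion that are far from being `H`-free -/

open Classical in
/-- A graph of the class that is far from being `H`-free has a clean subgraph containing `H`. -/
theorem HasBoundedExpansion.exists_clean {C : GraphClass} (hC : HasBoundedExpansion C)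
    {W : Type*} [Fintype W] (H : SimpleGraph W) {ε : ℝ} (hε : 0 < ε) :
    ∃ (K : ℕ) (γ : ℝ), 0 < γ ∧ ∀ n, ∀ G ∈ C n, IsFar ε (FreeOf H) G →
      ∃ G' r low φ, Clean H G G' r low K γ ∧ IsEmb H G' φ := by
  obtain ⟨f, hf⟩ := hC
  -- The degree bound needs at least `2`, and the colors of a copy of `H` need |W|.
  set p := Fintype.card W + 2 with hp
  obtain ⟨K, γ, hγ, hclean⟩ := _root_.exists_clean H (2 * 2 ^ f p * p) p
    (show 0 < ε / 2 ^ f p by positivity)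
  refine ⟨K, γ, hγ, fun n G hG hfar => ?_⟩
  obtain ⟨c, hc⟩ := hf n G hG p
  have hsum := sum_degree_le_of_isTreedepthColoring (by omega) G c hc
  have hS : ∀ S : Finset (Fin (f p)), ∃ (G' : SimpleGraph (Fin n)) (r : Fin n → Fin n → Prop)
      (low : Set (Fin n)),
      (((within G {v | c v ∈ S}).edgeSet \ G'.edgeSet).ncard : ℝ) ≤ ε / 2 ^ f p * n ∧
      (S.card ≤ p → Clean H G G' r low K γ) := by
    intro S
    by_cases h : S.card ≤ p
    · obtain ⟨r, hr, hl⟩ := exists_treeEmbedding_within G {v | c v ∈ S} p ((hc S h).trans h)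
      obtain ⟨G', -, hdel, low, hcl⟩ := hclean n G _ r (within_le G _) hr.1 hr.2 hl hsum
      exact ⟨G', r, low, hdel, fun _ => hcl⟩
    · exact ⟨within G {v | c v ∈ S}, fun _ _ => True, ∅, by simp; positivity, fun h' => absurd h' h⟩
  choose G' r low hdel hcl using hS
  -- All deletions together; the allowance for each color set was divided by the number of color
  -- sets.
  let R : Finset (Sym2 (Fin n)) := Finset.univ.biUnion fun S =>
    ((within G {v | c v ∈ S}).edgeSet \ (G' S).edgeSet).toFinset
  have hR : (R.card : ℝ) ≤ ε * n := by
    calc (R.card : ℝ) ≤ ∑ S : Finset (Fin (f p)),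
          (((within G {v | c v ∈ S}).edgeSet \ (G' S).edgeSet).ncard : ℝ) := by
            simp only [Set.ncard_eq_toFinset_card']
            exact_mod_cast Finset.card_biUnion_le
      _ ≤ ∑ S : Finset (Fin (f p)), ε / 2 ^ f p * n := Finset.sum_le_sum fun S _ => hdel S
      _ = ε * n := by
            rw [Finset.sum_const, nsmul_eq_mul, Finset.card_univ, Fintype.card_finset,
              Fintype.card_fin]
            push_cast
            field_simp
  have hnot : ¬ H.Free (G.deleteEdges R) := by
    intro hfree
    have h1 := hfar _ hfree
    have h2 : (symmDiff G.edgeSet (G.deleteEdges (R : Set (Sym2 (Fin n)))).edgeSet).ncard ≤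
        R.card := by
      rw [← Set.ncard_coe_finset]
      refine Set.ncard_le_ncard ?_ (Finset.finite_toSet _)
      rw [SimpleGraph.edgeSet_deleteEdges]
      rintro e (⟨h, h'⟩ | ⟨h, h'⟩)
      · by_contra hcon
        exact h' ⟨h, hcon⟩
      · exact absurd h.1 h'
    have h3 : ((symmDiff G.edgeSet (G.deleteEdges (R : Set (Sym2 (Fin n)))).edgeSet).ncard : ℝ) ≤
        R.card := by exact_mod_cast h2
    linarith
  obtain ⟨⟨g⟩⟩ := not_not.1 hnot
  let S : Finset (Fin (f p)) := Finset.univ.image fun w => c (g w)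
  have hScard : S.card ≤ p := Finset.card_image_le.trans (by rw [Finset.card_univ]; omega)
  rename_i hg
  refine ⟨G' S, r S, low S, g, hcl S hScard, hg, fun a b hab => ?_⟩
  have hadj := g.map_rel hab
  rw [SimpleGraph.deleteEdges_adj] at hadj
  by_contra hcon
  refine hadj.2 ?_
  simp only [R, Finset.coe_biUnion, Set.mem_iUnion]
  refine ⟨S, by simp, ?_⟩
  simp only [Set.coe_toFinset]
  exact ⟨⟨hadj.1, by simp [S], by simp [S]⟩, hcon⟩

/-! ### The tester -/

section Tester

/-- The answer at the position `j` of a list of answers, as a number. -/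
def answerAt (l : List (Option ℕ)) (j : ℕ) : ℕ := (l.getD j none).getD 0

/-- The position at which the round of the `i`-th query starts. A round consists of `M` queries, and
each query is preceded by two coin tosses. -/
def roundStart (M i : ℕ) : ℕ := 3 * M * (i / M)

/-- The vertex of the `i`-th query: the second coin selects one of the earlier answers of the round,
the last of which is the first coin, a random vertex. -/
def target (M : ℕ) (l : List (Option ℕ)) (i : ℕ) : ℕ :=
  answerAt l (roundStart M i + answerAt l (3 * i + 1) % (3 * i + 1 - roundStart M i))

/-- The `i`-th query has been made at `u`, and it has been answered by `v`. -/
def QueryAnswer (M : ℕ) (l : List (Option ℕ)) (i u v : ℕ) : Prop :=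
  3 * i + 2 < l.length ∧ target M l i = u ∧ l.getD (3 * i + 2) none = some v

/-- The edge between `u` and `v` has been found. -/
def FoundEdge (M : ℕ) (l : List (Option ℕ)) (u v : ℕ) : Prop :=
  ∃ i < l.length, QueryAnswer M l i u v ∨ QueryAnswer M l i v u

/-- A copy of `H` has been found; `c` encodes the map from the vertices of `H` by its digits. -/
def Detected {h : ℕ} (M : ℕ) (H : SimpleGraph (Fin h)) (n : ℕ) (l : List (Option ℕ)) : Prop :=
  ∃ c < n ^ h, ∀ pq : Fin h × Fin h,
    (pq.1 ≠ pq.2 → c / n ^ pq.1.val % n ≠ c / n ^ pq.2.val % n) ∧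
    (H.Adj pq.1 pq.2 → FoundEdge M l (c / n ^ pq.1.val % n) (c / n ^ pq.2.val % n))

open Classical in
/-- The tester: it makes `M * R` queries at random vertices or at random vertices that have been
discovered in the same round, and accepts unless it has found a copy of `H`. -/
noncomputable def tester {h : ℕ} (M R : ℕ) (H : SimpleGraph (Fin h)) : Procedure := fun x =>
  if x.2.length < 3 * M * R then
    -- For `n > 0` this coin ranges over the vertex set; for `n = 0` it is constantly `0`, and no
    -- query has a neighbor to return.
    if x.2.length % 3 = 0 then .inl (x.1 - 1)
    else if x.2.length % 3 = 1 then .inl (x.2.length - 1 - roundStart M (x.2.length / 3))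
    else .inr (.inl (target M x.2 (x.2.length / 3)))
  else .inr (.inr (decide (¬ Detected M H x.1 x.2)))

/-! ### The tester is computable -/

section Computability

open Primrec

variable {α : Type*} [Primcodable α]

theorem primrecPred_true : PrimrecPred fun _ : α => True :=
  (Primrec.eq.comp (const 0) (const (0 : ℕ))).of_eq fun _ => by simp

theorem PrimrecPred.const_imp {P : α → Prop} (hP : PrimrecPred P) (c : Prop) :
    PrimrecPred fun x => c → P x := by
  by_cases hc : c
  · exact hP.of_eq fun _ => by simp [hc]
  · exact primrecPred_true.of_eq fun _ => by simp [hc]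

theorem PrimrecPred.forall_finite {ι : Type*} [Fintype ι] {P : ι → α → Prop}
    (hP : ∀ i, PrimrecPred (P i)) : PrimrecPred fun x => ∀ i, P i x := by
  classical
  have h : ∀ s : Finset ι, PrimrecPred fun x => ∀ i ∈ s, P i x := by
    intro s
    induction s using Finset.induction_on with
    | empty => exact primrecPred_true.of_eq fun _ => by simp
    | insert i s _ ih => exact ((hP i).and ih).of_eq fun _ => by simp
  exact (h Finset.univ).of_eq fun _ => by simp

theorem primrec_pow_const {f : α → ℕ} (hf : Primrec f) (k : ℕ) : Primrec fun x => f x ^ k := by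
  induction k with
  | zero => exact (const 1).of_eq fun _ => by simp
  | succ k ih => exact (nat_mul.comp ih hf).of_eq fun _ => (pow_succ _ _).symm

theorem primrec_answerAt {l : α → List (Option ℕ)} {f : α → ℕ} (hl : Primrec l) (hf : Primrec f) :
    Primrec fun x => answerAt (l x) (f x) :=
  option_getD.comp ((list_getD none).comp hl hf) (const 0)

theorem primrec_roundStart (M : ℕ) {f : α → ℕ} (hf : Primrec f) :
    Primrec fun x => roundStart M (f x) :=
  nat_mul.comp (const _) (nat_div.comp hf (const _))

theorem primrec_target (M : ℕ) {l : α → List (Option ℕ)} {f : α → ℕ} (hl : Primrec l)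
    (hf : Primrec f) : Primrec fun x => target M (l x) (f x) := by
  have h1 : Primrec fun x => 3 * f x + 1 := nat_add.comp (nat_mul.comp (const 3) hf) (const 1)
  exact primrec_answerAt hl (nat_add.comp (primrec_roundStart M hf)
    (nat_mod.comp (primrec_answerAt hl h1) (nat_sub.comp h1 (primrec_roundStart M hf))))

theorem primrecPred_queryAnswer (M : ℕ) {l : α → List (Option ℕ)} {f u v : α → ℕ} (hl : Primrec l)
    (hf : Primrec f) (hu : Primrec u) (hv : Primrec v) :
    PrimrecPred fun x => QueryAnswer M (l x) (f x) (u x) (v x) := by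
  have h1 : Primrec fun x => 3 * f x + 2 := nat_add.comp (nat_mul.comp (const 3) hf) (const 2)
  exact (nat_lt.comp h1 (list_length.comp hl)).and ((Primrec.eq.comp (primrec_target M hl hf) hu).and
    (Primrec.eq.comp ((list_getD none).comp hl h1) (option_some.comp hv)))

theorem primrecPred_foundEdge (M : ℕ) {l : α → List (Option ℕ)} {u v : α → ℕ} (hl : Primrec l)
    (hu : Primrec u) (hv : Primrec v) : PrimrecPred fun x => FoundEdge M (l x) (u x) (v x) := by
  have hR : PrimrecRel fun (i : ℕ) (x : α) =>
      QueryAnswer M (l x) i (u x) (v x) ∨ QueryAnswer M (l x) i (v x) (u x) :=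
    (primrecPred_queryAnswer M (hl.comp snd) fst (hu.comp snd) (hv.comp snd)).or
      (primrecPred_queryAnswer M (hl.comp snd) fst (hv.comp snd) (hu.comp snd))
  have := (hR.exists_mem_list).comp (list_range.comp (list_length.comp hl)) Primrec.id
  exact this.of_eq fun x => by simp [FoundEdge]

/-- The codes `c` turn the search for a copy into a bounded quantifier. As `H` is fixed, its pairs
give a finite conjunction and its adjacencies are constants. -/
theorem primrecPred_detected {h : ℕ} (M : ℕ) (H : SimpleGraph (Fin h)) :
    PrimrecPred fun x : ℕ × List (Option ℕ) => Detected M H x.1 x.2 := by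
  have hdigit : ∀ p : Fin h, Primrec fun y : ℕ × (ℕ × List (Option ℕ)) =>
      y.1 / y.2.1 ^ p.val % y.2.1 := fun p =>
    nat_mod.comp (nat_div.comp fst (primrec_pow_const (fst.comp snd) _)) (fst.comp snd)
  have hR : PrimrecRel fun (c : ℕ) (x : ℕ × List (Option ℕ)) => ∀ pq : Fin h × Fin h,
      (pq.1 ≠ pq.2 → c / x.1 ^ pq.1.val % x.1 ≠ c / x.1 ^ pq.2.val % x.1) ∧
      (H.Adj pq.1 pq.2 → FoundEdge M x.2 (c / x.1 ^ pq.1.val % x.1) (c / x.1 ^ pq.2.val % x.1)) :=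
    PrimrecPred.forall_finite fun pq =>
      ((Primrec.eq.comp (hdigit pq.1) (hdigit pq.2)).not.const_imp _).and
        ((primrecPred_foundEdge M (snd.comp snd) (hdigit pq.1) (hdigit pq.2)).const_imp _)
  have := (hR.exists_mem_list).comp (list_range.comp (primrec_pow_const fst h)) Primrec.id
  exact this.of_eq fun x => by simp [Detected]

theorem computable_tester {h : ℕ} (M R : ℕ) (H : SimpleGraph (Fin h)) :
    Computable (tester M R H) := by
  classical
  refine Primrec.to_comp ?_
  have hlen : Primrec fun x : ℕ × List (Option ℕ) => x.2.length := list_length.comp snd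
  have hmod : Primrec fun x : ℕ × List (Option ℕ) => x.2.length % 3 := nat_mod.comp hlen (const 3)
  have hdiv : Primrec fun x : ℕ × List (Option ℕ) => x.2.length / 3 := nat_div.comp hlen (const 3)
  refine Primrec.ite (nat_lt.comp hlen (const _)) (Primrec.ite (Primrec.eq.comp hmod (const 0)) ?_
    (Primrec.ite (Primrec.eq.comp hmod (const 1)) ?_ ?_)) ?_
  · exact sumInl.comp (nat_sub.comp fst (const 1))
  · exact sumInl.comp (nat_sub.comp (nat_sub.comp hlen (const 1)) (primrec_roundStart M hdiv))
  · exact sumInr.comp (sumInl.comp (primrec_target M snd hdiv))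
  · exact sumInr.comp (sumInr.comp (primrecPred_detected M H).not.decide)

end Computability

/-! ### The edges found by the tester -/

theorem answerAt_append {l : List (Option ℕ)} (l' : List (Option ℕ)) {j : ℕ} (hj : j < l.length) :
    answerAt (l ++ l') j = answerAt l j := by
  simp [answerAt, List.getD_eq_getElem?_getD, List.getElem?_append_left hj]

theorem roundStart_le (M i : ℕ) : roundStart M i ≤ 3 * i := by
  unfold roundStart
  have := Nat.mul_div_le i M
  rw [mul_assoc]
  omega

theorem target_position_le (M : ℕ) (l : List (Option ℕ)) (i : ℕ) :
    roundStart M i + answerAt l (3 * i + 1) % (3 * i + 1 - roundStart M i) ≤ 3 * i := by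
  have h1 := roundStart_le M i
  have := Nat.mod_lt (answerAt l (3 * i + 1)) (show 0 < 3 * i + 1 - roundStart M i by omega)
  omega

theorem target_append {M : ℕ} {l : List (Option ℕ)} (l' : List (Option ℕ)) {i : ℕ}
    (hi : 3 * i + 1 < l.length) : target M (l ++ l') i = target M l i := by
  have h1 := target_position_le M l i
  unfold target
  rw [answerAt_append l' hi, answerAt_append l' (by omega)]

theorem QueryAnswer.append {M : ℕ} {l : List (Option ℕ)} {i u v : ℕ} (h : QueryAnswer M l i u v)
    (l' : List (Option ℕ)) : QueryAnswer M (l ++ l') i u v := by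
  obtain ⟨h1, h2, h3⟩ := h
  refine ⟨?_, ?_, ?_⟩
  · rw [List.length_append]; omega
  · rw [target_append l' (by omega), h2]
  · rw [← h3]
    simp [List.getD_eq_getElem?_getD, List.getElem?_append_left h1]

theorem FoundEdge.append {M : ℕ} {l : List (Option ℕ)} {u v : ℕ} (h : FoundEdge M l u v)
    (l' : List (Option ℕ)) : FoundEdge M (l ++ l') u v := by
  obtain ⟨i, hi, h⟩ := h
  refine ⟨i, ?_, h.imp (·.append l') (·.append l')⟩
  rw [List.length_append]
  omega

theorem Detected.append {h M n : ℕ} {H : SimpleGraph (Fin h)} {l : List (Option ℕ)}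
    (hd : Detected M H n l) (l' : List (Option ℕ)) : Detected M H n (l ++ l') := by
  obtain ⟨c, hc, hpq⟩ := hd
  exact ⟨c, hc, fun pq => ⟨(hpq pq).1, fun ha => ((hpq pq).2 ha).append l'⟩⟩

theorem detected_iff {h M n : ℕ} {H : SimpleGraph (Fin h)} {l : List (Option ℕ)} :
    Detected M H n l ↔ ∃ φ : Fin h → Fin n, Function.Injective φ ∧
      ∀ p q, H.Adj p q → FoundEdge M l (φ p) (φ q) := by
  constructor
  · rintro ⟨c, hc, hpq⟩
    refine ⟨finFunctionFinEquiv.symm ⟨c, hc⟩, fun p q hpq' => ?_, fun p q hadj => ?_⟩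
    · by_contra hne
      exact (hpq (p, q)).1 hne (congrArg Fin.val hpq')
    · exact (hpq (p, q)).2 hadj
  · rintro ⟨φ, hφ, hadj⟩
    have hdig : ∀ p : Fin h, (finFunctionFinEquiv φ : ℕ) / n ^ p.val % n = φ p := fun p =>
      congrArg Fin.val (congrFun (finFunctionFinEquiv.symm_apply_apply φ) p)
    refine ⟨finFunctionFinEquiv φ, Fin.is_lt _, fun pq => ?_⟩
    rw [hdig, hdig]
    exact ⟨fun hne h' => hne (hφ (Fin.val_injective h')), hadj _ _⟩

/-- The graph formed by the edges found by the queries from number `b` on. -/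
def foundGraph (M n : ℕ) (l : List (Option ℕ)) (b : ℕ) : SimpleGraph (Fin n) where
  Adj u v := u ≠ v ∧ ∃ i, b ≤ i ∧ (QueryAnswer M l i u v ∨ QueryAnswer M l i v u)
  symm := ⟨fun _ _ h => ⟨h.1.symm, h.2.imp fun _ hi => ⟨hi.1, hi.2.symm⟩⟩⟩
  loopless := ⟨fun _ h => h.1 rfl⟩

theorem foundGraph_append (M n : ℕ) (l l' : List (Option ℕ)) (b : ℕ) :
    foundGraph M n l b ≤ foundGraph M n (l ++ l') b := by
  rintro u v ⟨hne, i, hi, h⟩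
  exact ⟨hne, i, hi, h.imp (·.append l') (·.append l')⟩

theorem detected_of_isEmb {h M n b : ℕ} {H : SimpleGraph (Fin h)} {l : List (Option ℕ)}
    {φ : Fin h → Fin n} (hφ : IsEmb H (foundGraph M n l b) φ) : Detected M H n l := by
  refine detected_iff.2 ⟨φ, hφ.inj, fun p q hpq => ?_⟩
  obtain ⟨-, i, -, hi⟩ := hφ.adj p q hpq
  refine ⟨i, ?_, hi⟩
  rcases hi with h | h <;> have := h.1 <;> omega

/-- A discovered vertex is one of the answers of the round. -/
theorem exists_position_of_found {M n j i : ℕ} {l : List (Option ℕ)}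
    (hlen : l.length = 3 * i) (hi : i < M * j + M) {u v : Fin n}
    (hF : (foundGraph M n l (M * j)).Adj u v) :
    ∃ t, 3 * (M * j) + t < 3 * i ∧ answerAt l (3 * (M * j) + t) = u := by
  obtain ⟨-, k, hk, h⟩ := hF
  -- If `u` was queried, it stands at the position selected by the second coin; otherwise it is
  -- itself the answer, at position `3 * k + 2`.
  rcases h with ⟨h1, h2, h3⟩ | ⟨h1, h2, h3⟩
  · have hdiv : k / M = j := by
      refine Nat.div_eq_of_lt_le ?_ ?_
      · rw [mul_comm]; exact hk
      · rw [Nat.succ_mul, mul_comm]; omega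
    have hrs : roundStart M k = 3 * (M * j) := by rw [roundStart, hdiv, mul_assoc]
    have hle := target_position_le M l k
    rw [target] at h2
    rw [hrs] at hle h2
    exact ⟨_, by omega, h2⟩
  · refine ⟨3 * k + 2 - 3 * (M * j), by omega, ?_⟩
    rw [show 3 * (M * j) + (3 * k + 2 - 3 * (M * j)) = 3 * k + 2 by omega, answerAt, h3]
    rfl

end Tester

/-! ### Lower bounds for the probability of finding an edge -/

section Probability

theorem PMF.mul_le_toOuterMeasure_bind {α β : Type*} (p : PMF α) (f : α → PMF β) {A : Set α}
    {B : Set β} {a c : ℝ≥0∞} (ha : a ≤ p.toOuterMeasure A)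
    (h : ∀ x ∈ A, c ≤ (f x).toOuterMeasure B) : a * c ≤ (p.bind f).toOuterMeasure B := by
  refine (mul_le_mul_left ha c).trans ?_
  rw [PMF.toOuterMeasure_bind_apply, PMF.toOuterMeasure_apply, ← ENNReal.tsum_mul_right]
  refine ENNReal.tsum_le_tsum fun x => ?_
  by_cases hx : x ∈ A
  · rw [Set.indicator_of_mem hx]
    exact mul_le_mul_right (h x hx) _
  · rw [Set.indicator_of_notMem hx, zero_mul]
    exact zero_le

theorem PMF.toOuterMeasure_bind_le {α β : Type*} (p : PMF α) (f : α → PMF β) {A : Set α}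
    {B : Set β} {c : ℝ≥0∞} (h : ∀ x ∈ p.support, x ∈ A → (f x).toOuterMeasure B ≤ c)
    (h' : ∀ x ∈ p.support, x ∉ A → (f x).toOuterMeasure B = 0) :
    (p.bind f).toOuterMeasure B ≤ p.toOuterMeasure A * c := by
  rw [PMF.toOuterMeasure_bind_apply, PMF.toOuterMeasure_apply, ← ENNReal.tsum_mul_right]
  refine ENNReal.tsum_le_tsum fun x => ?_
  by_cases hp : p x = 0
  · simp [hp]
  · have hxs : x ∈ p.support := hp
    by_cases hx : x ∈ A
    · rw [Set.indicator_of_mem hx]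
      exact mul_le_mul_right (h x hxs hx) _
    · rw [h' x hxs hx, mul_zero]
      exact zero_le

theorem PMF.toOuterMeasure_add_compl {α : Type*} (p : PMF α) (A : Set α) :
    p.toOuterMeasure A + p.toOuterMeasure Aᶜ = 1 := by
  rw [PMF.toOuterMeasure_apply, PMF.toOuterMeasure_apply, ← ENNReal.tsum_add, ← p.tsum_coe]
  refine tsum_congr fun x => ?_
  by_cases hx : x ∈ A <;> simp [hx]

variable {n : ℕ}

/-- The law of the state after `k` further steps from the state `s`. -/
noncomputable def iterStep (T : Procedure) (G : SimpleGraph (Fin n)) :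
    ℕ → List (Option ℕ) × ℕ → PMF (List (Option ℕ) × ℕ)
  | 0, s => PMF.pure s
  | k + 1, s => (step T G s).bind (iterStep T G k)

theorem run_add (T : Procedure) (G : SimpleGraph (Fin n)) (t k : ℕ) :
    run T G (t + k) = (run T G t).bind (iterStep T G k) := by
  induction k generalizing t with
  | zero => exact (PMF.bind_pure _).symm
  | succ k ih =>
    rw [show t + (k + 1) = (t + 1) + k by omega, ih]
    change ((run T G t).bind (step T G)).bind _ = _
    rw [PMF.bind_bind]
    rfl

theorem iterStep_add (T : Procedure) (G : SimpleGraph (Fin n)) (k k' : ℕ)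
    (s : List (Option ℕ) × ℕ) :
    iterStep T G (k + k') s = (iterStep T G k s).bind (iterStep T G k') := by
  induction k generalizing s with
  | zero => rw [Nat.zero_add]; exact (PMF.pure_bind _ _).symm
  | succ k ih =>
    rw [show k + 1 + k' = (k + k') + 1 by omega]
    change (step T G s).bind _ = ((step T G s).bind _).bind _
    rw [PMF.bind_bind]
    congr 1
    funext x
    exact ih x

theorem le_iterStep_three (T : Procedure) (G : SimpleGraph (Fin n)) {s : List (Option ℕ) × ℕ}
    {A₁ A₂ A₃ : Set (List (Option ℕ) × ℕ)} {a₁ a₂ a₃ : ℝ≥0∞}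
    (h₁ : a₁ ≤ (step T G s).toOuterMeasure A₁)
    (h₂ : ∀ s' ∈ A₁, a₂ ≤ (step T G s').toOuterMeasure A₂)
    (h₃ : ∀ s' ∈ A₂, a₃ ≤ (step T G s').toOuterMeasure A₃) :
    a₁ * (a₂ * a₃) ≤ (iterStep T G 3 s).toOuterMeasure A₃ := by
  refine PMF.mul_le_toOuterMeasure_bind _ _ h₁ fun s' hs' => ?_
  refine PMF.mul_le_toOuterMeasure_bind _ _ (h₂ s' hs') fun s'' hs'' => ?_
  change _ ≤ ((step T G s'').bind PMF.pure).toOuterMeasure A₃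
  rw [PMF.bind_pure]
  exact h₃ s'' hs''

theorem le_step_coin {T : Procedure} (G : SimpleGraph (Fin n)) {s : List (Option ℕ) × ℕ} {k : ℕ}
    (hT : T (n, s.1) = .inl k) (U : Finset (Fin (k + 1))) {S : Set (List (Option ℕ) × ℕ)}
    (hS : ∀ i ∈ U, (s.1 ++ [some i.val], s.2) ∈ S) :
    (U.card : ℝ≥0∞) / (k + 1 : ℕ) ≤ (step T G s).toOuterMeasure S := by
  classical
  have : step T G s = (PMF.uniformOfFintype (Fin (k + 1))).map fun i : Fin (k + 1) =>
      (s.1 ++ [some i.val], s.2) := by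
    unfold step
    rw [hT]
  rw [this, PMF.toOuterMeasure_map_apply, PMF.toOuterMeasure_uniformOfFintype_apply, Fintype.card_fin]
  refine ENNReal.div_le_div_right ?_ _
  rw [Nat.cast_le, ← Fintype.card_coe]
  exact Fintype.card_le_of_injective (fun i => ⟨i.1, hS i.1 i.2⟩)
    fun i j hij => Subtype.ext (congrArg (fun x => x.1) hij)

open Classical in
theorem le_step_query {T : Procedure} (G : SimpleGraph (Fin n)) {s : List (Option ℕ) × ℕ}
    {v : Fin n} (hT : T (n, s.1) = .inr (.inl v.val)) {Y : Finset (Fin n)}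
    (hY : Y ⊆ G.neighborFinset v) (hne : Y.Nonempty) {S : Set (List (Option ℕ) × ℕ)}
    (hS : ∀ y ∈ Y, (s.1 ++ [some y.val], s.2 + 1) ∈ S) :
    (Y.card : ℝ≥0∞) / G.degree v ≤ (step T G s).toOuterMeasure S := by
  have hex : ∃ hv : v.val < n, (G.neighborFinset ⟨v.val, hv⟩).Nonempty := ⟨v.2, hne.mono hY⟩
  have : step T G s = ((PMF.uniformOfFinset (G.neighborFinset v) (hne.mono hY)).map
      fun w : Fin n => some w.val).map fun a => (s.1 ++ [a], s.2 + 1) := by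
    unfold step
    rw [hT]
    dsimp only
    rw [randomNeighbor, dif_pos hex]
  rw [this, PMF.toOuterMeasure_map_apply, PMF.toOuterMeasure_map_apply,
    PMF.toOuterMeasure_uniformOfFinset_apply, SimpleGraph.card_neighborFinset_eq_degree]
  refine ENNReal.div_le_div_right ?_ _
  rw [Nat.cast_le]
  exact Finset.card_le_card fun y hy => Finset.mem_filter.2 ⟨hY hy, hS y hy⟩

theorem step_support {T : Procedure} {G : SimpleGraph (Fin n)} {s s' : List (Option ℕ) × ℕ}
    (h : s' ∈ (step T G s).support) :
    (∃ b, T (n, s.1) = .inr (.inr b) ∧ s' = s) ∨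
    (∃ k i, T (n, s.1) = .inl k ∧ s' = (s.1 ++ [some i], s.2)) ∨
    (∃ v a, T (n, s.1) = .inr (.inl v) ∧ a ∈ (randomNeighbor G v).support ∧
      s' = (s.1 ++ [a], s.2 + 1)) := by
  unfold step at h
  split at h
  · rename_i k hk
    rw [PMF.mem_support_map_iff] at h
    obtain ⟨i, -, rfl⟩ := h
    exact Or.inr (Or.inl ⟨k, i, hk, rfl⟩)
  · rename_i v hv
    rw [PMF.mem_support_map_iff] at h
    obtain ⟨a, ha, rfl⟩ := h
    exact Or.inr (Or.inr ⟨v, a, hv, ha, rfl⟩)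
  · rename_i b hb
    exact Or.inl ⟨b, hb, by simpa using h⟩

theorem adj_of_mem_randomNeighbor {G : SimpleGraph (Fin n)} {u v : ℕ}
    (h : some v ∈ (randomNeighbor G u).support) :
    ∃ (hu : u < n) (hv : v < n), G.Adj ⟨u, hu⟩ ⟨v, hv⟩ := by
  classical
  unfold randomNeighbor at h
  split_ifs at h with hex
  · rw [PMF.mem_support_map_iff] at h
    obtain ⟨w, hw, hwv⟩ := h
    rw [PMF.mem_support_uniformOfFinset_iff] at hw
    obtain rfl : w.val = v := Option.some.inj hwv
    refine ⟨hex.choose, w.2, ?_⟩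
    have := (SimpleGraph.mem_neighborFinset _ _ _).1 hw
    exact this
  · simp at h

end Probability

/-! ### Analysis of the tester -/

section Analysis

variable {h n M R : ℕ} {H : SimpleGraph (Fin h)}

theorem tester_first_coin {l : List (Option ℕ)} {i : ℕ} (hl : l.length = 3 * i) (hi : i < M * R) :
    tester M R H (n, l) = .inl (n - 1) := by
  have h1 : l.length < 3 * M * R := by rw [mul_assoc]; omega
  have h2 : l.length % 3 = 0 := by omega
  simp only [tester, if_pos h1, if_pos h2]

theorem tester_second_coin {l : List (Option ℕ)} {i : ℕ} (hl : l.length = 3 * i + 1)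
    (hi : i < M * R) : tester M R H (n, l) = .inl (3 * i - roundStart M i) := by
  have h1 : l.length < 3 * M * R := by rw [mul_assoc]; omega
  have h2 : ¬ l.length % 3 = 0 := by omega
  have h3 : l.length % 3 = 1 := by omega
  simp only [tester, if_pos h1, if_neg h2, if_pos h3]
  rw [show l.length - 1 = 3 * i by omega, show l.length / 3 = i by omega]

theorem tester_query {l : List (Option ℕ)} {i : ℕ} (hl : l.length = 3 * i + 2) (hi : i < M * R) :
    tester M R H (n, l) = .inr (.inl (target M l i)) := by
  have h1 : l.length < 3 * M * R := by rw [mul_assoc]; omega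
  have h2 : ¬ l.length % 3 = 0 := by omega
  have h3 : ¬ l.length % 3 = 1 := by omega
  simp only [tester, if_pos h1, if_neg h2, if_neg h3]
  rw [show l.length / 3 = i by omega]

open Classical in
theorem tester_verdict {l : List (Option ℕ)} (hl : 3 * M * R ≤ l.length) :
    tester M R H (n, l) = .inr (.inr (decide (¬ Detected M H n l))) := by
  simp only [tester, if_neg (not_lt.2 hl)]

theorem tester_eq_verdict {l : List (Option ℕ)} {b : Bool}
    (hb : tester M R H (n, l) = .inr (.inr b)) : 3 * M * R ≤ l.length := by
  classical
  by_contra hlt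
  rw [not_le] at hlt
  simp only [tester, if_pos hlt] at hb
  split_ifs at hb; all_goals simp at hb

theorem tester_eq_query {l : List (Option ℕ)} {v : ℕ}
    (hv : tester M R H (n, l) = .inr (.inl v)) :
    l.length < 3 * M * R ∧ ∃ i, l.length = 3 * i + 2 ∧ target M l i = v := by
  classical
  unfold tester at hv
  split_ifs at hv with h1 h2 h3
  · refine ⟨h1, l.length / 3, ?_, Sum.inl.inj (Sum.inr.inj hv)⟩
    dsimp only at h2 h3
    omega
  · simp at hv

theorem tester_eq_coin {l : List (Option ℕ)} {k : ℕ} (hk : tester M R H (n, l) = .inl k) :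
    l.length < 3 * M * R ∧ ¬ l.length % 3 = 2 := by
  classical
  unfold tester at hk
  split_ifs at hk with h1 h2 h3
  · exact ⟨h1, by dsimp only at h2; omega⟩
  · exact ⟨h1, by dsimp only at h3; omega⟩

variable {G : SimpleGraph (Fin n)}

theorem iterStep_tester_support {k : ℕ} {s s' : List (Option ℕ) × ℕ}
    (hs : s' ∈ (iterStep (tester M R H) G k s).support) :
    (∃ l', s'.1 = s.1 ++ l') ∧ (s.1.length + k ≤ 3 * M * R → s'.1.length = s.1.length + k) := by
  induction k generalizing s with
  | zero =>
    have : s' = s := by simpa [iterStep] using hs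
    subst this
    exact ⟨⟨[], by simp⟩, fun _ => rfl⟩
  | succ k ih =>
    obtain ⟨s₁, hs₁, hs'⟩ := (PMF.mem_support_bind_iff _ _ _).1 hs
    obtain ⟨⟨l', hl'⟩, hlen⟩ := ih hs'
    have happ : ∀ a, s₁.1 = s.1 ++ [a] → (∃ l', s'.1 = s.1 ++ l') ∧
        (s.1.length + (k + 1) ≤ 3 * M * R → s'.1.length = s.1.length + (k + 1)) := by
      intro a ha
      refine ⟨⟨[a] ++ l', by rw [hl', ha, List.append_assoc]⟩, fun hle => ?_⟩
      have h1 : s₁.1.length = s.1.length + 1 := by rw [ha]; simp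
      rw [hlen (by omega)]
      omega
    rcases step_support hs₁ with ⟨b, hb, rfl⟩ | ⟨_, i, -, rfl⟩ | ⟨_, a, -, -, rfl⟩
    · refine ⟨⟨l', hl'⟩, fun hle => ?_⟩
      have := tester_eq_verdict hb
      omega
    · exact happ _ rfl
    · exact happ _ rfl

open Classical in
/-- The `i`-th query reveals a new edge, provided that the random vertex lies in `U`, that the
second coin selects a certain discovered vertex, and that the answer lies in a certain set. -/
theorem le_iterStep_tester {s : List (Option ℕ) × ℕ} {i j D : ℕ} (hlen : s.1.length = 3 * i)
    (hi : i < M * R) (hj : M * j ≤ i) (hj' : i < M * j + M) (U : Finset (Fin (n - 1 + 1)))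
    (P : List (Option ℕ) → Prop)
    (hU : ∀ u ∈ U, ∃ (t : ℕ) (v : Fin n) (Y : Finset (Fin n)), 3 * (M * j) + t ≤ 3 * i ∧
      answerAt (s.1 ++ [some u.val]) (3 * (M * j) + t) = v ∧ Y ⊆ G.neighborFinset v ∧ Y.Nonempty ∧
      G.degree v ≤ D * Y.card ∧
      ∀ y ∈ Y, ∀ l', foundGraph M n s.1 (M * j) ≤ foundGraph M n l' (M * j) →
        (foundGraph M n l' (M * j)).Adj v y → P l') :
    (U.card : ℝ≥0∞) / (n - 1 + 1 : ℕ) * (((3 * M : ℕ) : ℝ≥0∞)⁻¹ * (D : ℝ≥0∞)⁻¹) ≤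
      (iterStep (tester M R H) G 3 s).toOuterMeasure
        {s' | s'.1.length = 3 * (i + 1) ∧ P s'.1} := by
  have hdiv : i / M = j := by
    refine Nat.div_eq_of_lt_le ?_ ?_
    · rw [mul_comm]; exact hj
    · rw [Nat.succ_mul, mul_comm]; omega
  have hrs : roundStart M i = 3 * (M * j) := by rw [roundStart, hdiv, mul_assoc]
  choose! t hU using hU
  let A₁ : Set (List (Option ℕ) × ℕ) := {s' | ∃ u ∈ U, s'.1 = s.1 ++ [some u.val]}
  let A₂ : Set (List (Option ℕ) × ℕ) :=
    {s' | ∃ u ∈ U, s'.1 = s.1 ++ [some u.val] ++ [some (t u)]}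
  refine le_iterStep_three (A₁ := A₁) (A₂ := A₂) _ _ ?_ ?_ ?_
  · exact le_step_coin G (tester_first_coin hlen hi) U fun u hu => ⟨u, hu, rfl⟩
  · rintro s' ⟨u, hu, hs'⟩
    have hl' : s'.1.length = 3 * i + 1 := by rw [hs']; simp [hlen]
    have htu : t u < 3 * i - roundStart M i + 1 := by
      obtain ⟨-, -, ht, -⟩ := hU u hu
      omega
    refine le_trans ?_ (le_step_coin G (tester_second_coin hl' hi) {⟨t u, htu⟩} ?_)
    -- A round has `3 * M` answers, so the second coin hits a prescribed position with probability
    -- at least `1 / (3 * M)`.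
    · rw [Finset.card_singleton, Nat.cast_one, ENNReal.inv_le_iff_inv_le, one_div, inv_inv,
        Nat.cast_le]
      omega
    · intro c hc
      rw [Finset.mem_singleton.1 hc]
      exact ⟨u, hu, by rw [hs']⟩
  · rintro s' ⟨u, hu, hs'⟩
    obtain ⟨v, Y, ht, hv, hY, hYne, hYD, hYP⟩ := hU u hu
    have hl₁ : (s.1 ++ [some u.val]).length = 3 * i + 1 := by simp [hlen]
    have hl' : s'.1.length = 3 * i + 2 := by rw [hs']; simp [hlen]
    have hc : answerAt s'.1 (3 * i + 1) = t u := by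
      rw [hs', ← hl₁]
      simp [answerAt, List.getD_eq_getElem?_getD]
    have htarget : target M s'.1 i = v := by
      rw [target, hc, hrs, Nat.mod_eq_of_lt (by omega), hs', answerAt_append _ (by omega), hv]
    have hq : tester M R H (n, s'.1) = .inr (.inl v.val) := by
      rw [tester_query hl' hi, htarget]
    refine le_trans ?_ (le_step_query G hq hY hYne ?_)
    · have hpos : 0 < Y.card := hYne.card_pos
      have hdeg : 0 < G.degree v := by
        rw [← SimpleGraph.card_neighborFinset_eq_degree]
        exact hpos.trans_le (Finset.card_le_card hY)
      have hD : D ≠ 0 := by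
        rintro rfl
        omega
      rw [ENNReal.le_div_iff_mul_le (Or.inl (by exact_mod_cast hdeg.ne')) (Or.inl (by simp)),
        mul_comm, ← div_eq_mul_inv, ENNReal.div_le_iff (by exact_mod_cast hD) (by simp), mul_comm]
      exact_mod_cast hYD
    · intro y hy
      have hadj : G.Adj v y := by simpa using hY hy
      refine ⟨?_, ?_⟩
      · simp [hl']
        omega
      · dsimp only
        have hle : foundGraph M n s.1 (M * j) ≤ foundGraph M n (s'.1 ++ [some y.val]) (M * j) := by
          rw [hs', List.append_assoc, List.append_assoc]
          exact foundGraph_append _ _ _ _ _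
        refine hYP y hy _ hle ⟨hadj.ne, i, hj, Or.inl ⟨?_, ?_, ?_⟩⟩
        · simp [hl']
        · rw [target_append _ (by omega), htarget]
        · rw [← hl']
          simp [List.getD_eq_getElem?_getD]

end Analysis

/-! ### Success of a round and amplification -/

section Success

variable {h n M R : ℕ} {H : SimpleGraph (Fin h)} {G G' : SimpleGraph (Fin n)}
  {r : Fin n → Fin n → Prop} {low : Set (Fin n)} {K D : ℕ} {γ : ℝ}

/-- A lower bound for the probability that the next query makes progress. -/
noncomputable def progressProb (M D : ℕ) : ℝ≥0∞ :=
  (D : ℝ≥0∞)⁻¹ * (((3 * M : ℕ) : ℝ≥0∞)⁻¹ * (D : ℝ≥0∞)⁻¹)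

theorem inv_natCast_le_one {k : ℕ} (hk : 0 < k) : (k : ℝ≥0∞)⁻¹ ≤ 1 :=
  ENNReal.inv_le_one.2 (by exact_mod_cast hk)

theorem progressProb_le_one (hM : 0 < M) (hD : 0 < D) : progressProb M D ≤ 1 :=
  mul_le_one' (inv_natCast_le_one hD)
    (mul_le_one' (inv_natCast_le_one (by omega)) (inv_natCast_le_one hD))

theorem progressProb_pos (M D : ℕ) : 0 < progressProb M D := by
  have h : ∀ k : ℕ, (k : ℝ≥0∞)⁻¹ ≠ 0 := fun k => ENNReal.inv_ne_zero.2 (by simp)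
  exact pos_iff_ne_zero.2 (mul_ne_zero (h _) (mul_ne_zero (h _) (h _)))

theorem progressProb_le_iterStep (hc : Clean H G G' r low K γ) (hM : 0 < M) (hD : 0 < D)
    (hDγ : 1 / (D : ℝ) ≤ γ) (hDK : K ≤ D) {s : List (Option ℕ) × ℕ} {i j m : ℕ}
    (hlen : s.1.length = 3 * i) (hi : i < M * R) (hj : M * j ≤ i) (hj' : i < M * j + M)
    (hex : Explorable H G' r low (m + 1) (foundGraph M n s.1 (M * j))) :
    progressProb M D ≤ (iterStep (tester M R H) G 3 s).toOuterMeasure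
      {s' | s'.1.length = 3 * (i + 1) ∧ Explorable H G' r low m (foundGraph M n s'.1 (M * j))} := by
  classical
  have hDR : (0 : ℝ) < D := by exact_mod_cast hD
  have hscale : ∀ a b : ℕ, 1 / (D : ℝ) * a ≤ b → a ≤ D * b := by
    intro a b hab
    rw [div_mul_eq_mul_div, one_mul, div_le_iff₀ hDR] at hab
    rw [mul_comm]
    exact_mod_cast hab
  have hδK : 1 / (D : ℝ) * K ≤ 1 := by
    rw [div_mul_eq_mul_div, one_mul, div_le_one hDR]
    exact_mod_cast hDK
  rcases hex.progress hc hDγ hδK (by positivity) with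
    hdone | ⟨v, u, huv, Y, hY, hYne, hYD, hYP⟩ | ⟨Y, hYne, hYD, hYP⟩
  · refine (progressProb_le_one hM hD).trans (le_of_eq ?_)
    symm
    rw [PMF.toOuterMeasure_apply_eq_one_iff]
    intro s' hs'
    obtain ⟨⟨l', hl'⟩, hlen'⟩ := iterStep_tester_support hs'
    refine ⟨by rw [hlen' (by rw [mul_assoc]; omega)]; omega, ?_⟩
    rw [hl']
    exact hdone.mono le_rfl (foundGraph_append _ _ _ _ _)
  -- The query is made at a discovered vertex, so every value of the first coin is acceptable.
  · obtain ⟨t, ht, hv⟩ := exists_position_of_found hlen hj' huv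
    refine le_trans ?_ (le_iterStep_tester (D := D) hlen hi hj hj' Finset.univ
      (fun l => Explorable H G' r low m (foundGraph M n l (M * j))) fun u' _ =>
      ⟨t, v, Y, ht.le, ?_, hY, hYne, hscale _ _ hYD, fun y hy l' hl' hadj => hYP y hy _ hl' hadj⟩)
    · rw [Finset.card_univ, Fintype.card_fin,
        ENNReal.div_self (by simp) (ENNReal.natCast_ne_top _), progressProb]
      gcongr
      exact inv_natCast_le_one hD
    · rw [answerAt_append _ (by omega), hv]
  -- The query is made at a random vertex: the first coin falls into `Y`, the second selects the
  -- first one, at position `3 * i`, and the answer is one prescribed neighbor among at most `K ≤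
  -- D`.
  · have hn : n ≤ n - 1 + 1 := by omega
    let U : Finset (Fin (n - 1 + 1)) := Y.map (Fin.castLEEmb hn)
    refine le_trans ?_ (le_iterStep_tester (D := D) hlen hi hj hj' U
      (fun l => Explorable H G' r low m (foundGraph M n l (M * j))) fun u hu => ?_)
    · have hn0 : 0 < n := (Fin.pos_iff_nonempty.2 ⟨hYne.choose⟩)
      have hU : (D : ℝ≥0∞)⁻¹ ≤ (U.card : ℝ≥0∞) / (n - 1 + 1 : ℕ) := by
        have hle := hscale _ _ hYD
        rw [Fintype.card_fin] at hle
        rw [Finset.card_map, show n - 1 + 1 = n by omega,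
          ENNReal.le_div_iff_mul_le (Or.inl (by exact_mod_cast hn0.ne')) (Or.inl (by simp)),
          mul_comm, ← div_eq_mul_inv, ENNReal.div_le_iff (by exact_mod_cast hD.ne') (by simp),
          mul_comm]
        exact_mod_cast hle
      exact mul_le_mul_left hU _
    · obtain ⟨y, hy, rfl⟩ := Finset.mem_map.1 hu
      obtain ⟨hdeg, z, hyz, hP⟩ := hYP y hy
      refine ⟨3 * i - 3 * (M * j), y, {z}, by omega, ?_, by simpa using hyz,
        Finset.singleton_nonempty _, by simpa using hdeg.trans hDK, ?_⟩
      · rw [show 3 * (M * j) + (3 * i - 3 * (M * j)) = 3 * i by omega, ← hlen]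
        simp [answerAt, List.getD_eq_getElem?_getD]
      · intro w hw l' hl' hadj
        rw [Finset.mem_singleton.1 hw] at hadj
        exact hP _ hl' hadj

/-- The conditional probabilities of `k` successive lucky queries multiply. Edges count from query
`M * j` on, since only answers of the current round can be queried again. -/
theorem pow_progressProb_le_iterStep (hc : Clean H G G' r low K γ) (hM : 0 < M) (hD : 0 < D)
    (hDγ : 1 / (D : ℝ) ≤ γ) (hDK : K ≤ D) {j : ℕ} (hjR : j < R) (k : ℕ)
    {s : List (Option ℕ) × ℕ} {i : ℕ} (hlen : s.1.length = 3 * i) (hj : M * j ≤ i)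
    (hik : i + k ≤ M * j + M)
    (hex : Explorable H G' r low k (foundGraph M n s.1 (M * j))) :
    progressProb M D ^ k ≤ (iterStep (tester M R H) G (3 * k) s).toOuterMeasure
      {s' | Detected M H n s'.1} := by
  induction k generalizing s i with
  | zero =>
    obtain ⟨φ, hφ⟩ := hex.exists_isEmb
    have hmem : s ∈ {s' : List (Option ℕ) × ℕ | Detected M H n s'.1} := detected_of_isEmb hφ
    change _ ≤ (PMF.pure s).toOuterMeasure _
    rw [PMF.toOuterMeasure_pure_apply, if_pos hmem, pow_zero]
  | succ k ih =>
    have hiR : i < M * R := by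
      have : M * (j + 1) ≤ M * R := Nat.mul_le_mul_left _ hjR
      rw [Nat.mul_succ] at this
      omega
    rw [show 3 * (k + 1) = 3 + 3 * k by ring, iterStep_add, pow_succ']
    refine PMF.mul_le_toOuterMeasure_bind _ _
      (progressProb_le_iterStep hc hM hD hDγ hDK hlen hiR hj (by omega) hex) ?_
    rintro s' ⟨hlen', hex'⟩
    exact ih hlen' (by omega) (by omega) hex'

theorem run_eq_iterStep (T : Procedure) (G : SimpleGraph (Fin n)) (t : ℕ) :
    run T G t = iterStep T G t ([], 0) := by
  rw [← Nat.zero_add t, run_add, Nat.zero_add]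
  exact PMF.pure_bind _ _

theorem run_tester_length {t : ℕ} (ht : t ≤ 3 * M * R) {s : List (Option ℕ) × ℕ}
    (hs : s ∈ (run (tester M R H) G t).support) : s.1.length = t := by
  rw [run_eq_iterStep] at hs
  simpa using (iterStep_tester_support hs).2 (by simpa using ht)

theorem run_not_detected_le (hc : Clean H G G' r low K γ) (hM : 0 < M) (hD : 0 < D)
    (hDγ : 1 / (D : ℝ) ≤ γ) (hDK : K ≤ D) (hHM : H.edgeSet.ncard ≤ M) {φ : Fin h → Fin n}
    (hφ : IsEmb H G' φ) (j : ℕ) (hjR : j ≤ R) :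
    (run (tester M R H) G (3 * M * j)).toOuterMeasure {s | Detected M H n s.1}ᶜ ≤
      (1 - progressProb M D ^ M) ^ j := by
  induction j with
  | zero =>
    rw [pow_zero, ← PMF.toOuterMeasure_add_compl (run (tester M R H) G (3 * M * 0))
      {s | Detected M H n s.1}]
    exact le_add_self
  | succ j ih =>
    rw [show 3 * M * (j + 1) = 3 * M * j + 3 * M by ring, run_add, pow_succ]
    refine (PMF.toOuterMeasure_bind_le (A := {s : List (Option ℕ) × ℕ | Detected M H n s.1}ᶜ)
      (c := 1 - progressProb M D ^ M) _ _ ?_ ?_).trans (mul_le_mul_left (ih (by omega)) _)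
    · intro s hs _
      have hlen : s.1.length = 3 * (M * j) := by
        have hle : 3 * M * j ≤ 3 * M * R := Nat.mul_le_mul_left _ (by omega)
        rw [run_tester_length hle hs, mul_assoc]
      -- Every round starts afresh from the empty exploration of the same copy, so its bound holds
      -- whatever happened before.
      have hex : Explorable H G' r low M (foundGraph M n s.1 (M * j)) :=
        hφ.explorable.mono hHM le_rfl
      have hle := pow_progressProb_le_iterStep (G := G) hc hM hD hDγ hDK (show j < R by omega) M hlen
        le_rfl le_rfl hex
      have hadd := PMF.toOuterMeasure_add_compl (iterStep (tester M R H) G (3 * M) s)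
        {s' | Detected M H n s'.1}
      have hne : (iterStep (tester M R H) G (3 * M) s).toOuterMeasure
          {s' | Detected M H n s'.1} ≠ ⊤ := by
        intro h
        rw [h, top_add] at hadd
        exact ENNReal.top_ne_one hadd
      rw [ENNReal.eq_sub_of_add_eq' ENNReal.one_ne_top ((add_comm _ _).trans hadd)]
      exact tsub_le_tsub_left hle 1
    · intro s _ hs
      rw [PMF.toOuterMeasure_apply_eq_zero_iff, Set.disjoint_left]
      intro s' hs' hs''
      obtain ⟨⟨l', hl'⟩, -⟩ := iterStep_tester_support hs'
      refine hs'' ?_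
      change Detected M H n s'.1
      rw [hl']
      exact (not_not.1 hs).append l'

/-! ### The verdict -/

/-- The last clause makes the error one-sided: only oracle answers, never coins, are read as ends of
edges. -/
theorem run_tester_support {t : ℕ} {s : List (Option ℕ) × ℕ}
    (hs : s ∈ (run (tester M R H) G t).support) :
    s.1.length ≤ 3 * M * R ∧ s.2 ≤ s.1.length ∧ ∀ i u v, QueryAnswer M s.1 i u v →
      ∃ (hu : u < n) (hv : v < n), G.Adj ⟨u, hu⟩ ⟨v, hv⟩ := by
  induction t generalizing s with
  | zero =>
    have : s = ([], 0) := by simpa [run] using hs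
    subst this
    refine ⟨Nat.zero_le _, le_rfl, fun i u v h => ?_⟩
    have := h.1
    simp at this
  | succ t ih =>
    obtain ⟨s₀, hs₀, hs'⟩ := (PMF.mem_support_bind_iff _ _ _).1 hs
    obtain ⟨h1, h2, h3⟩ := ih hs₀
    have happ : ∀ a i u v, QueryAnswer M (s₀.1 ++ [a]) i u v → QueryAnswer M s₀.1 i u v ∨
        s₀.1.length = 3 * i + 2 ∧ target M s₀.1 i = u ∧ a = some v := by
      rintro a i u v ⟨g1, g2, g3⟩
      rw [List.length_append, List.length_singleton] at g1
      rw [target_append _ (by omega)] at g2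
      by_cases hlt : 3 * i + 2 < s₀.1.length
      · left
        refine ⟨hlt, g2, ?_⟩
        rw [← g3]
        simp [List.getD_eq_getElem?_getD, List.getElem?_append_left hlt]
      · right
        have hl : s₀.1.length = 3 * i + 2 := by omega
        refine ⟨hl, g2, ?_⟩
        rw [← g3, ← hl]
        simp [List.getD_eq_getElem?_getD]
    rcases step_support hs' with ⟨_, -, rfl⟩ | ⟨k, c, hk, rfl⟩ | ⟨v, a, hv, ha, rfl⟩
    · exact ⟨h1, h2, h3⟩
    · obtain ⟨g1, g2⟩ := tester_eq_coin hk
      refine ⟨by simpa using g1, by simpa using h2.trans (Nat.le_succ _), fun i u v hq => ?_⟩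
      rcases happ _ i u v hq with hq | ⟨hq, -⟩
      · exact h3 i u v hq
      · omega
    · obtain ⟨g1, i₀, g2, g3⟩ := tester_eq_query hv
      refine ⟨by simpa using g1, by simpa using h2, fun i u w hq => ?_⟩
      rcases happ _ i u w hq with hq | ⟨hq, hu, hw⟩
      · exact h3 i u w hq
      · obtain rfl : i = i₀ := by omega
        rw [g3] at hu
        subst hu hw
        exact adj_of_mem_randomNeighbor ha

/-- The state is frozen once the verdict is reached, so the supremum in `verdictProb` is the value
at time `3 * M * R`. -/
theorem run_tester_add (k : ℕ) :
    run (tester M R H) G (3 * M * R + k) = run (tester M R H) G (3 * M * R) := by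
  have hhalt : ∀ k (s : List (Option ℕ) × ℕ), 3 * M * R ≤ s.1.length →
      iterStep (tester M R H) G k s = PMF.pure s := by
    intro k s hs
    induction k with
    | zero => rfl
    | succ k ih =>
      have hstep : step (tester M R H) G s = PMF.pure s := by
        unfold step
        rw [tester_verdict hs]
      change (step (tester M R H) G s).bind _ = _
      rw [hstep, PMF.pure_bind, ih]
  rw [run_add]
  refine PMF.ext fun x => ?_
  conv_rhs => rw [← PMF.bind_pure (run (tester M R H) G (3 * M * R))]
  rw [PMF.bind_apply, PMF.bind_apply]
  refine tsum_congr fun s => ?_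
  by_cases hs : run (tester M R H) G (3 * M * R) s = 0
  · rw [hs, zero_mul, zero_mul]
  · rw [hhalt k s (run_tester_length le_rfl hs).ge]

open Classical in
theorem verdictProb_tester (b : Bool) :
    verdictProb (tester M R H) G b = (run (tester M R H) G (3 * M * R)).toOuterMeasure
      {s | decide (¬ Detected M H n s.1) = b} := by
  have hmap : ∀ t, ((run (tester M R H) G t).map fun s => tester M R H (n, s.1)) (.inr (.inr b)) =
      (run (tester M R H) G t).toOuterMeasure {s | tester M R H (n, s.1) = .inr (.inr b)} := by
    intro t
    rw [← PMF.toOuterMeasure_apply_singleton, PMF.toOuterMeasure_map_apply]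
    rfl
  have hlast : ((run (tester M R H) G (3 * M * R)).map fun s => tester M R H (n, s.1))
      (.inr (.inr b)) = (run (tester M R H) G (3 * M * R)).toOuterMeasure
        {s | decide (¬ Detected M H n s.1) = b} := by
    rw [hmap]
    refine PMF.toOuterMeasure_apply_eq_of_inter_support_eq _ ?_
    ext s
    refine and_congr_left fun hs => ?_
    change tester M R H (n, s.1) = _ ↔ _ = b
    rw [tester_verdict (run_tester_length le_rfl hs).ge]
    simp
  refine le_antisymm (iSup_le fun t => ?_) (hlast ▸ le_iSup (fun t =>
    ((run (tester M R H) G t).map fun s => tester M R H (n, s.1)) (.inr (.inr b))) (3 * M * R))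
  rcases lt_or_ge t (3 * M * R) with ht | ht
  · rw [hmap, (PMF.toOuterMeasure_apply_eq_zero_iff _ _).2]
    · exact zero_le
    · refine Set.disjoint_left.2 fun s hs hs' => ?_
      have := tester_eq_verdict hs'
      rw [run_tester_length ht.le hs] at this
      omega
  · obtain ⟨k, rfl⟩ := Nat.exists_eq_add_of_le ht
    rw [run_tester_add, hlast]

theorem acceptProb_tester : acceptProb (tester M R H) G =
    (run (tester M R H) G (3 * M * R)).toOuterMeasure {s | Detected M H n s.1}ᶜ := by
  classical
  rw [acceptProb, verdictProb_tester]
  congr 1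
  ext s
  simp

theorem rejectProb_tester : rejectProb (tester M R H) G =
    (run (tester M R H) G (3 * M * R)).toOuterMeasure {s | Detected M H n s.1} := by
  classical
  rw [rejectProb, verdictProb_tester]
  congr 1
  ext s
  simp

theorem isAlgorithm_tester (M R : ℕ) (H : SimpleGraph (Fin h)) : IsAlgorithm (tester M R H) := by
  refine ⟨computable_tester M R H, fun n G => ?_⟩
  rw [acceptProb_tester, rejectProb_tester, add_comm]
  exact PMF.toOuterMeasure_add_compl _ _

theorem hasQueryBound_tester (M R : ℕ) (H : SimpleGraph (Fin h)) :
    HasQueryBound (tester M R H) (3 * M * R) := by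
  intro n G t s hs
  obtain ⟨h1, h2, -⟩ := run_tester_support hs
  -- A crude bound that counts the coins as well.
  exact h2.trans h1

theorem hasOneSidedError_tester (M R : ℕ) (H : SimpleGraph (Fin h)) :
    HasOneSidedError (tester M R H) (FreeOf H) := by
  intro n G hG
  rw [acceptProb_tester, PMF.toOuterMeasure_apply_eq_one_iff]
  intro s hs hdet
  obtain ⟨-, -, h3⟩ := run_tester_support hs
  obtain ⟨φ, hφ, hadj⟩ := detected_iff.1 hdet
  refine hG ⟨⟨⟨φ, fun {p q} hpq => ?_⟩, hφ⟩⟩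
  obtain ⟨i, -, hi | hi⟩ := hadj p q hpq
  · exact (h3 _ _ _ hi).2.2
  · exact (h3 _ _ _ hi).2.2.symm

theorem two_thirds_le_rejectProb (hc : Clean H G G' r low K γ) (hM : 0 < M) (hD : 0 < D)
    (hDγ : 1 / (D : ℝ) ≤ γ) (hDK : K ≤ D) (hHM : H.edgeSet.ncard ≤ M) {φ : Fin h → Fin n}
    (hφ : IsEmb H G' φ) (hR : (1 - progressProb M D ^ M) ^ R ≤ 1 / 3) :
    2 / 3 ≤ rejectProb (tester M R H) G := by
  have hfail := (run_not_detected_le hc hM hD hDγ hDK hHM hφ R le_rfl).trans hR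
  have hadd := PMF.toOuterMeasure_add_compl (run (tester M R H) G (3 * M * R))
    {s | Detected M H n s.1}
  rw [← rejectProb_tester] at hadd
  have hne : (run (tester M R H) G (3 * M * R)).toOuterMeasure {s | Detected M H n s.1}ᶜ ≠ ⊤ :=
    ne_top_of_le_ne_top (ENNReal.div_ne_top ENNReal.one_ne_top (by simp)) hfail
  refine ENNReal.le_of_add_le_add_right hne ?_
  rw [hadd]
  refine (add_le_add_right hfail _).trans (le_of_eq ?_)
  rw [← ENNReal.add_div, show (2 : ℝ≥0∞) + 1 = 3 by norm_num]
  exact ENNReal.div_self (by simp) (by simp)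

end Success

theorem exists_tester_of_hasBoundedExpansion (C : GraphClass) (hC : HasBoundedExpansion C) {h : ℕ}
    (H : SimpleGraph (Fin h)) (ε : ℝ) (hε : 0 < ε) :
    ∃ (q : ℕ) (T : Procedure),
      IsTester T C (FreeOf H) ε ∧ HasQueryBound T q ∧ HasOneSidedError T (FreeOf H) := by
  obtain ⟨K, γ, hγ, hclean⟩ := hC.exists_clean H hε
  -- `1 / D` serves both as the proportion of alternatives and as the chance to hit one neighbor of
  -- a low vertex.
  obtain ⟨D, hD0, hDK, hDγ⟩ : ∃ D : ℕ, 0 < D ∧ K ≤ D ∧ 1 / (D : ℝ) ≤ γ := by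
    refine ⟨max (K + 1) ⌈1 / γ⌉₊, by simp, (Nat.le_succ K).trans (le_max_left _ _), ?_⟩
    have hpos : (0 : ℝ) < (max (K + 1) ⌈1 / γ⌉₊ : ℕ) :=
      Nat.cast_pos.2 ((Nat.succ_pos K).trans_le (le_max_left _ _))
    rw [one_div_le hpos hγ]
    exact (Nat.le_ceil _).trans (Nat.cast_le.2 (le_max_right _ _))
  -- The summand `1` keeps rounds nonempty if `H` has no edges.
  set M := H.edgeSet.ncard + 1 with hM
  obtain ⟨R, hR⟩ : ∃ R, (1 - progressProb M D ^ M) ^ R ≤ 1 / 3 := by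
    have hlt : 1 - progressProb M D ^ M < 1 :=
      ENNReal.sub_lt_self ENNReal.one_ne_top one_ne_zero (ENNReal.pow_pos (progressProb_pos M D) M).ne'
    have htend := ENNReal.tendsto_pow_atTop_nhds_zero_of_lt_one hlt
    have hpos : (0 : ℝ≥0∞) < 1 / 3 := ENNReal.div_pos one_ne_zero (by simp)
    obtain ⟨R, hR⟩ := (htend.eventually (gt_mem_nhds hpos)).exists
    exact ⟨R, hR.le⟩
  refine ⟨3 * M * R, tester M R H, ⟨isAlgorithm_tester M R H, fun n G hG => ⟨fun hfree => ?_,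
    fun hfar => ?_⟩⟩, hasQueryBound_tester M R H, hasOneSidedError_tester M R H⟩
  · rw [hasOneSidedError_tester M R H n G hfree]
    exact ENNReal.div_le_of_le_mul (by norm_num)
  · obtain ⟨G', r, low, φ, hc, hφ⟩ := hclean n G hG hfar
    exact two_thirds_le_rejectProb hc (Nat.succ_pos _) hD0 hDγ hDK (Nat.le_succ _) hφ hR

theorem mainTheorem1 (C : GraphClass) (hC : HasBoundedExpansion C)
    {W : Type*} [Finite W] (H : SimpleGraph W) (ε : ℝ) (hε : 0 < ε) :
    ∃ (q : ℕ) (T : Procedure),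
      IsTester T C (FreeOf H) ε ∧ HasQueryBound T q ∧ HasOneSidedError T (FreeOf H) := by
  obtain ⟨h, ⟨e⟩⟩ := Finite.exists_equiv_fin W
  have hfree : FreeOf H = FreeOf (H.map e.toEmbedding) := by
    funext n
    ext G
    exact SimpleGraph.free_congr (SimpleGraph.Iso.map e H) SimpleGraph.Iso.refl
  rw [hfree]
  exact exists_tester_of_hasBoundedExpansion C hC _ ε hε
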